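/- Let $s\ge 1$, and let $\mathcal F=\bigoplus_{n\ge0}\mathcal F_n$ be the bosonic Fock space over $L^2(\mathbb R^s)$, where $\mathcal F_n$ is the subspace of totally symmetric vectors in $L^2(\mathbb R^s)^{\otimes n}$ and $\mathcal F_0=\mathbb C\,\Omega$; put $h_1\otimes_s\cdots\otimes_s h_n=\frac1{n!}\sum_\pi h_{\pi(1)}\otimes\cdots\otimes h_{\pi(n)}$. For $f\in\mathcal D(\mathbb R^s)$ (smooth, complex valued, compactly supported) let $\phi(f)$ be the selfadjoint field operator, i.e. the closure of $a^*(f)+a(f)$ on the vectors of finite particle number. Let $\mathfrak R$ be the norm closed algebra generated by all resolvents $(i\lambda+\phi(f))^{-1}$, $\lambda\in\mathbb R\setminus\{0\}$, $f\in\mathcal D(\mathbb R^s)$, and let $\mathfrak A\subset\mathfrak R$ be the subalgebra of the elements that commute with all gauge transformations $e^{itN}$, $t\in\mathbb R$, where $N$ is the particle number operator. For $A\in\mathfrak A$ let $\|A\|_n$ be the operator norm of the restriction $A\restriction\mathcal F_n$. For a compact operator $C_m$ on $\mathcal F_m$ and $n\ge m$ let $C_{m,n}=C_m\otimes_s 1\otimes_s\cdots\otimes_s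 1$ ($n-m$ factors $1$) be the symmetrized tensor product, an operator on $\mathcal F_n$. **Lemma 3.4.** Let $A\in\mathfrak A$ and $n\ge1$. 1. Let $f_1,\dots,f_n,g_1,\dots,g_n\in\mathcal D(\mathbb R^s)$. For $x\in\mathbb R^s$ let $f_n(x)$ denote the function $f_n$ translated by $x$, put $\Phi^n(x)=f_1\otimes_s\cdots\otimes_s f_{n-1}\otimes_s f_n(x)$ and $\Phi^{n-1}=f_1\otimes_s\cdots\otimes_s f_{n-1}$ (with $\Phi^0=\Omega$), and define $\Psi^n(x)$, $\Psi^{n-1}$ in the same way from $g_1,\dots,g_n$. Then $$\lim_{x\to\infty}\langle\Psi^n(x),A\,\Phi^n(x)\rangle=\frac1n\,\langle\Psi^{n-1},A\,\Phi^{n-1}\rangle\,\langle g_n,f_n\rangle .$$ 2. $\|A\|_{n-1}\le\|A\|_n$. 3. If $A\restriction\mathcal F_n=\sum_{m=0}^n C_{m,n}$ for some compact operators $C_m$ on $\mathcal F_m$, $0\le m\le n$, then $$A\restriction\mathcal F_{n-1}=\sum_{m=0}^{n-1}\frac{n-m}{n}\,C_{m,n-1}.$$ -/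

import Mathlib

open MeasureTheory Filter Topology
open scoped ENNReal ContDiff Distributions InnerProductSpace

noncomputable section

namespace BoseResolvent

/-! ### Tensor products of square integrable functions -/

section Tensor

variable {X Y Z : Type*} [MeasurableSpace X] [MeasurableSpace Y] [MeasurableSpace Z]

/-- The Hilbert space of square integrable complex functions. -/
abbrev L2 (μ : Measure X) : Type _ := Lp ℂ 2 μ

variable {μ : Measure X} {ν : Measure Y} {ρ : Measure Z}

theorem memLp_tensor [SFinite μ] [SFinite ν] {p : Z → X × Y} (hp : MeasurePreserving p ρ (μ.prod ν))
    (ψ : L2 μ) (χ : L2 ν) : MemLp (fun z => ψ (p z).1 * χ (p z).2) 2 ρ := by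
  have h : MemLp (fun q : X × Y => ψ q.1 * χ q.2) 2 (μ.prod ν) := by
    have h1 := (memLp_two_iff_integrable_sq_norm (Lp.memLp ψ).1).1 (Lp.memLp ψ)
    have h2 := (memLp_two_iff_integrable_sq_norm (Lp.memLp χ).1).1 (Lp.memLp χ)
    have hm : AEStronglyMeasurable (fun q : X × Y => ψ q.1 * χ q.2) (μ.prod ν) :=
      (Lp.memLp ψ).1.comp_fst.mul (Lp.memLp χ).1.comp_snd
    refine (memLp_two_iff_integrable_sq_norm hm).2 ?_
    simpa [mul_pow] using h1.mul_prod h2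
  exact h.comp_measurePreserving hp

/-- If the measure space `Z` is identified with `X × Y` by `p`, this is the tensor product
`(ψ ⊗ χ)(z) = ψ(x) χ(y)`, `p z = (x, y)`, of `ψ ∈ L²(X)` and `χ ∈ L²(Y)`, an element of `L²(Z)`. -/
def tensor [SFinite μ] [SFinite ν] {p : Z → X × Y} (hp : MeasurePreserving p ρ (μ.prod ν)) (ψ : L2 μ) (χ : L2 ν) : L2 ρ :=
  (memLp_tensor hp ψ χ).toLp _

variable {p : Z → X × Y}

theorem ae_fst [SFinite μ] [SFinite ν] (hp : MeasurePreserving p ρ (μ.prod ν))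
    {P : X → Prop} (h : ∀ᵐ x ∂μ, P x) : ∀ᵐ z ∂ρ, P (p z).1 :=
  (Measure.quasiMeasurePreserving_fst.comp hp.quasiMeasurePreserving).ae h

theorem ae_snd [SFinite μ] [SFinite ν] (hp : MeasurePreserving p ρ (μ.prod ν))
    {P : Y → Prop} (h : ∀ᵐ y ∂ν, P y) : ∀ᵐ z ∂ρ, P (p z).2 :=
  (Measure.quasiMeasurePreserving_snd.comp hp.quasiMeasurePreserving).ae h

variable [SFinite μ] [SFinite ν] (hp : MeasurePreserving p ρ (μ.prod ν))

theorem coeFn_tensor (ψ : L2 μ) (χ : L2 ν) :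
    tensor hp ψ χ =ᵐ[ρ] fun z => ψ (p z).1 * χ (p z).2 :=
  (memLp_tensor hp ψ χ).coeFn_toLp

theorem tensor_add_left (ψ ψ' : L2 μ) (χ : L2 ν) :
    tensor hp (ψ + ψ') χ = tensor hp ψ χ + tensor hp ψ' χ := by
  apply Lp.ext
  filter_upwards [coeFn_tensor hp (ψ + ψ') χ, coeFn_tensor hp ψ χ, coeFn_tensor hp ψ' χ,
    Lp.coeFn_add (tensor hp ψ χ) (tensor hp ψ' χ), ae_fst hp (Lp.coeFn_add ψ ψ')]
    with z h1 h2 h3 h4 h5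
  rw [h1, h4, Pi.add_apply, h2, h3, h5, Pi.add_apply, add_mul]

theorem tensor_smul_left (c : ℂ) (ψ : L2 μ) (χ : L2 ν) :
    tensor hp (c • ψ) χ = c • tensor hp ψ χ := by
  apply Lp.ext
  filter_upwards [coeFn_tensor hp (c • ψ) χ, coeFn_tensor hp ψ χ,
    Lp.coeFn_smul c (tensor hp ψ χ), ae_fst hp (Lp.coeFn_smul c ψ)]
    with z h1 h2 h3 h4
  rw [h1, h3, Pi.smul_apply, h2, h4, Pi.smul_apply, smul_eq_mul, smul_eq_mul, mul_assoc]

theorem tensor_add_right (ψ : L2 μ) (χ χ' : L2 ν) :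
    tensor hp ψ (χ + χ') = tensor hp ψ χ + tensor hp ψ χ' := by
  apply Lp.ext
  filter_upwards [coeFn_tensor hp ψ (χ + χ'), coeFn_tensor hp ψ χ, coeFn_tensor hp ψ χ',
    Lp.coeFn_add (tensor hp ψ χ) (tensor hp ψ χ'), ae_snd hp (Lp.coeFn_add χ χ')]
    with z h1 h2 h3 h4 h5
  rw [h1, h4, Pi.add_apply, h2, h3, h5, Pi.add_apply, mul_add]

theorem tensor_smul_right (c : ℂ) (ψ : L2 μ) (χ : L2 ν) :
    tensor hp ψ (c • χ) = c • tensor hp ψ χ := by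
  apply Lp.ext
  filter_upwards [coeFn_tensor hp ψ (c • χ), coeFn_tensor hp ψ χ,
    Lp.coeFn_smul c (tensor hp ψ χ), ae_snd hp (Lp.coeFn_smul c χ)]
    with z h1 h2 h3 h4
  rw [h1, h3, Pi.smul_apply, h2, h4, Pi.smul_apply, smul_eq_mul, smul_eq_mul, mul_left_comm]

theorem inner_tensor (ψ ψ' : L2 μ) (χ χ' : L2 ν) :
    ⟪tensor hp ψ χ, tensor hp ψ' χ'⟫_ℂ = ⟪ψ, ψ'⟫_ℂ * ⟪χ, χ'⟫_ℂ := by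
  have h1 : ⟪tensor hp ψ χ, tensor hp ψ' χ'⟫_ℂ
      = ∫ z, (fun q : X × Y => ⟪ψ q.1, ψ' q.1⟫_ℂ * ⟪χ q.2, χ' q.2⟫_ℂ) (p z) ∂ρ := by
    rw [MeasureTheory.L2.inner_def]
    refine integral_congr_ae ?_
    filter_upwards [coeFn_tensor hp ψ χ, coeFn_tensor hp ψ' χ'] with z h1 h2
    simp only [h1, h2, RCLike.inner_apply, map_mul]
    ring
  rw [h1, MeasureTheory.L2.inner_def, MeasureTheory.L2.inner_def, ← integral_prod_mul,
    ← hp.map_eq, integral_map hp.measurable.aemeasurable]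
  rw [hp.map_eq]
  exact ((MeasureTheory.L2.integrable_inner ψ ψ').mul_prod
    (MeasureTheory.L2.integrable_inner χ χ')).1

theorem norm_tensor (ψ : L2 μ) (χ : L2 ν) : ‖tensor hp ψ χ‖ = ‖ψ‖ * ‖χ‖ := by
  have h : (‖tensor hp ψ χ‖ : ℂ) ^ 2 = ((‖ψ‖ * ‖χ‖ : ℝ) : ℂ) ^ 2 := by
    have h1 := inner_tensor hp ψ ψ χ χ
    simp only [inner_self_eq_norm_sq_to_K] at h1
    push_cast
    rw [mul_pow]
    exact h1
  have h' : ‖tensor hp ψ χ‖ ^ 2 = (‖ψ‖ * ‖χ‖) ^ 2 := by exact_mod_cast h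
  exact (pow_left_inj₀ (norm_nonneg _) (by positivity) two_ne_zero).1 h'

/-- The bounded linear map `χ ↦ ψ ⊗ χ`. -/
def tensorL (ψ : L2 μ) : L2 ν →L[ℂ] L2 ρ :=
  LinearMap.mkContinuous
    { toFun := fun χ => tensor hp ψ χ
      map_add' := tensor_add_right hp ψ
      map_smul' := fun c χ => tensor_smul_right hp c ψ χ }
    ‖ψ‖ (fun χ => (norm_tensor hp ψ χ).le)

/-- The bounded linear map `ψ ↦ ψ ⊗ χ`. -/
def tensorR (χ : L2 ν) : L2 μ →L[ℂ] L2 ρ :=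
  LinearMap.mkContinuous
    { toFun := fun ψ => tensor hp ψ χ
      map_add' := fun ψ ψ' => tensor_add_left hp ψ ψ' χ
      map_smul' := fun c ψ => tensor_smul_left hp c ψ χ }
    ‖χ‖ (fun ψ => (norm_tensor hp ψ χ).le.trans (mul_comm _ _).le)

end Tensor

/-! ### Diagonal operators on Hilbert sums -/

section Diag

variable {ι : Type*} {G : ι → Type*} [∀ i, NormedAddCommGroup (G i)]
  [∀ i, InnerProductSpace ℂ (G i)]

theorem memlp_diag (T : ∀ i, G i →L[ℂ] G i) {K : ℝ} (hK : ∀ i, ‖T i‖ ≤ K) (ψ : lp G 2) :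
    Memℓp (fun i => T i (ψ i)) 2 := by
  have h := (lp.memℓp ψ).summable (by norm_num)
  refine memℓp_gen ?_
  simp only [ENNReal.toReal_ofNat, Real.rpow_ofNat] at h ⊢
  refine Summable.of_nonneg_of_le (fun _ => by positivity) (fun i => ?_) (h.mul_left (K ^ 2))
  rw [← mul_pow]
  exact pow_le_pow_left₀ (norm_nonneg _)
    (((T i).le_opNorm _).trans (mul_le_mul_of_nonneg_right (hK i) (norm_nonneg _))) 2

/-- The operator `⊕ᵢ Tᵢ` on a Hilbert sum, for a bounded family of operators `Tᵢ`. -/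
def diag (T : ∀ i, G i →L[ℂ] G i) {K : ℝ} (hK : ∀ i, ‖T i‖ ≤ K) : lp G 2 →L[ℂ] lp G 2 :=
  LinearMap.mkContinuous
    { toFun := fun ψ => ⟨fun i => T i (ψ i), memlp_diag T hK ψ⟩
      map_add' := fun ψ χ => by ext i; exact map_add (T i) _ _
      map_smul' := fun c ψ => by ext i; exact map_smul (T i) _ _ }
    |K| (fun ψ => by
      have h2 : (0 : ℝ) < (2 : ℝ≥0∞).toReal := by norm_num
      refine lp.norm_le_of_forall_sum_le h2 (by positivity) (fun s => ?_)
      have h3 := lp.sum_rpow_le_norm_rpow h2 ψ s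
      simp only [ENNReal.toReal_ofNat, Real.rpow_ofNat] at h3 ⊢
      rw [mul_pow, sq_abs]
      refine le_trans ?_ (mul_le_mul_of_nonneg_left h3 (sq_nonneg K))
      rw [Finset.mul_sum]
      refine Finset.sum_le_sum (fun i _ => ?_)
      rw [← mul_pow]
      exact pow_le_pow_left₀ (norm_nonneg _)
        (((T i).le_opNorm _).trans (mul_le_mul_of_nonneg_right (hK i) (norm_nonneg _))) 2)

theorem diag_apply (T : ∀ i, G i →L[ℂ] G i) {K : ℝ} (hK : ∀ i, ‖T i‖ ≤ K) (ψ : lp G 2) (i : ι) :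
    diag T hK ψ i = T i (ψ i) := rfl

end Diag

/-! ### The operator `C ⊗ 1` -/

section TensorOne

variable {X Y Z : Type*} [MeasurableSpace X] [MeasurableSpace Y] [MeasurableSpace Z]
  {μ : Measure X} {ν : Measure Y} {ρ : Measure Z} [SFinite μ] [SFinite ν]
  {p : Z → X × Y} (hp : MeasurePreserving p ρ (μ.prod ν))

theorem exists_tensorOne (C : L2 μ →L[ℂ] L2 μ) :
    ∃ T : L2 ρ →L[ℂ] L2 ρ, ∀ ψ χ, T (tensor hp ψ χ) = tensor hp (C ψ) χ := by
  obtain ⟨w, b, -⟩ := exists_hilbertBasis ℂ (L2 ν)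
  have hb := b.orthonormal
  let V : w → L2 μ →ₗᵢ[ℂ] L2 ρ := fun i =>
    { toLinearMap := (tensorR hp (b i)).toLinearMap
      norm_map' := fun ψ => (norm_tensor hp ψ (b i)).trans (by rw [hb.1 i, mul_one]) }
  have hV : OrthogonalFamily ℂ (fun _ : w => L2 μ) V := by
    intro i j hij ψ ψ'
    refine (inner_tensor hp ψ ψ' (b i) (b j)).trans ?_
    rw [hb.2 hij, mul_zero]
  let J : lp (fun _ : w => L2 μ) 2 →L[ℂ] L2 ρ := hV.linearIsometry.toContinuousLinearMap
  have hJJ : ∀ v, ContinuousLinearMap.adjoint J (J v) = v := fun v => by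
    refine ext_inner_right ℂ (fun u => ?_)
    rw [ContinuousLinearMap.adjoint_inner_left]
    exact hV.linearIsometry.inner_map_map v u
  let D : lp (fun _ : w => L2 μ) 2 →L[ℂ] lp (fun _ : w => L2 μ) 2 :=
    diag (fun _ => C) (fun _ => le_refl ‖C‖)
  refine ⟨J ∘L D ∘L ContinuousLinearMap.adjoint J, fun ψ χ => ?_⟩
  have hmem : ∀ φ : L2 μ, Memℓp (fun i : w => b.repr χ i • φ) 2 := fun φ => by
    have h := (lp.memℓp (b.repr χ)).summable (by norm_num)
    refine memℓp_gen ?_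
    simp only [ENNReal.toReal_ofNat, Real.rpow_ofNat, norm_smul, mul_pow] at h ⊢
    exact h.mul_right _
  let v : L2 μ → lp (fun _ : w => L2 μ) 2 := fun φ => ⟨_, hmem φ⟩
  have hJv : ∀ φ, J (v φ) = tensor hp φ χ := fun φ => by
    have h1 : HasSum (fun i => V i (v φ i)) (J (v φ)) := hV.hasSum_linearIsometry (v φ)
    have h2 := (tensorL hp φ).hasSum (b.hasSum_repr χ)
    have h3 : (fun i => V i (v φ i)) = (fun i => tensorL hp φ (b.repr χ i • b i)) := by
      funext i
      exact (tensor_smul_left hp _ φ (b i)).trans (tensor_smul_right hp _ φ (b i)).symm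
    rw [h3] at h1
    exact h1.unique h2
  have hDv : D (v ψ) = v (C ψ) := by
    ext1
    funext i
    exact map_smul C _ _
  change J (D (ContinuousLinearMap.adjoint J (tensor hp ψ χ))) = _
  rw [← hJv ψ, hJJ, hDv, hJv]

/-- The operator `C ⊗ 1` on `L²(Z) = L²(X) ⊗ L²(Y)`: the bounded operator which maps
`ψ ⊗ χ` to `C ψ ⊗ χ`. -/
def tensorOne (C : L2 μ →L[ℂ] L2 μ) : L2 ρ →L[ℂ] L2 ρ := (exists_tensorOne hp C).choose

theorem tensorOne_tensor (C : L2 μ →L[ℂ] L2 μ) (ψ : L2 μ) (χ : L2 ν) :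
    tensorOne hp C (tensor hp ψ χ) = tensor hp (C ψ) χ := (exists_tensorOne hp C).choose_spec ψ χ

end TensorOne

/-! ### Bosonic Fock space over `L²(ℝˢ)` -/

section Fock

/-- The space `ℝˢ`. -/
abbrev Space (s : ℕ) : Type := EuclideanSpace ℝ (Fin s)

/-- The one-particle space `L²(ℝˢ)`. -/
abbrev OneParticle (s : ℕ) : Type := L2 (volume : Measure (Space s))

/-- The unsymmetrized `n`-particle space `L²(ℝˢ) ⊗ ⋯ ⊗ L²(ℝˢ)`, in the form `L²((ℝˢ)ⁿ)`.
For `n = 0` the underlying space is a point of mass one, so that the space is `ℂ`. -/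
abbrev Unsymm (s n : ℕ) : Type := L2 (volume : Measure (Fin n → Space s))

theorem measurePreserving_perm (s n : ℕ) (π : Equiv.Perm (Fin n)) :
    MeasurePreserving (fun (x : Fin n → Space s) i => x (π.symm i)) volume volume := by
  convert! volume_measurePreserving_piCongrLeft (fun _ => Space s) π using 1
  funext x i
  obtain ⟨j, rfl⟩ := π.surjective i
  rw [MeasurableEquiv.coe_piCongrLeft, Equiv.piCongrLeft_apply_apply, Equiv.symm_apply_apply]

/-- The unitary `U(π)`, `U(π) (f₁ ⊗ ⋯ ⊗ fₙ) = f_π(1) ⊗ ⋯ ⊗ f_π(n)`. -/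
def permL (s n : ℕ) (π : Equiv.Perm (Fin n)) : Unsymm s n →ₗᵢ[ℂ] Unsymm s n :=
  Lp.compMeasurePreservingₗᵢ ℂ _ (measurePreserving_perm s n π)

theorem permL_permL (s n : ℕ) (τ π : Equiv.Perm (Fin n)) (ψ : Unsymm s n) :
    permL s n τ (permL s n π ψ) = permL s n (π * τ) ψ :=
  (Lp.compMeasurePreserving_comp_apply ψ (measurePreserving_perm s n π)
    (measurePreserving_perm s n τ)).symm

/-- The `n`-particle space of totally symmetric wave functions. -/
def Symm (s n : ℕ) : Submodule ℂ (Unsymm s n) where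
  carrier := {ψ | ∀ π, permL s n π ψ = ψ}
  add_mem' := fun hψ hχ π => by rw [map_add, hψ π, hχ π]
  zero_mem' := fun π => map_zero _
  smul_mem' := fun c ψ hψ π => by rw [map_smul, hψ π]

instance (s n : ℕ) : CompleteSpace (Symm s n) := by
  have h : IsClosed (Symm s n : Set (Unsymm s n)) := by
    have : (Symm s n : Set (Unsymm s n)) = ⋂ π, {ψ | permL s n π ψ = ψ} := by
      ext ψ
      simp [Symm]
    rw [this]
    exact isClosed_iInter fun π => isClosed_eq (permL s n π).continuous continuous_id
  exact h.completeSpace_coe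

/-- The mean `(1/n!) ∑_π U(π)` over the symmetric group, the orthogonal projection onto the
symmetric subspace. -/
def symmetrize (s n : ℕ) : Unsymm s n →L[ℂ] Symm s n :=
  ((n.factorial : ℂ)⁻¹ • ∑ π : Equiv.Perm (Fin n),
    (permL s n π).toContinuousLinearMap).codRestrict (Symm s n) (fun ψ τ => by
      simp only [smul_apply, sum_apply, map_smul, map_sum,
        LinearIsometry.coe_toContinuousLinearMap]
      congr 1
      refine Fintype.sum_equiv (Equiv.mulRight τ) _ _ (fun π => ?_)
      rw [permL_permL]
      rfl)

/-- The inclusion of the symmetric into the unsymmetrized `n`-particle space. -/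
abbrev symmIncl (s n : ℕ) : Symm s n →L[ℂ] Unsymm s n := (Symm s n).subtypeL

theorem memLp_prodVec {s n : ℕ} (f : Fin n → OneParticle s) :
    MemLp (fun x : Fin n → Space s => ∏ i, f i (x i)) 2 volume := by
  have hm : AEStronglyMeasurable (fun x : Fin n → Space s => ∏ i, f i (x i)) volume := by
    refine Finset.aestronglyMeasurable_fun_prod _ (fun i _ => ?_)
    exact (Lp.memLp (f i)).1.comp_quasiMeasurePreserving
      (Measure.quasiMeasurePreserving_eval (fun _ : Fin n => (volume : Measure (Space s))) i)
  refine (memLp_two_iff_integrable_sq_norm hm).2 ?_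
  have h : ∀ i, Integrable (fun y => ‖f i y‖ ^ 2) (volume : Measure (Space s)) := fun i =>
    (memLp_two_iff_integrable_sq_norm (Lp.memLp (f i)).1).1 (Lp.memLp (f i))
  have h' := Integrable.fintype_prod (f := fun i y => ‖f i y‖ ^ 2) h
  simp only [norm_prod, ← Finset.prod_pow]
  exact h'

/-- The product vector `f₁ ⊗ ⋯ ⊗ fₙ`. -/
def prodVec {s n : ℕ} (f : Fin n → OneParticle s) : Unsymm s n := (memLp_prodVec f).toLp _

/-- The symmetric product vector
`f₁ ⊗ₛ ⋯ ⊗ₛ fₙ = (1/n!) ∑_π f_π(1) ⊗ ⋯ ⊗ f_π(n)`. -/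
def symmVec {s n : ℕ} (f : Fin n → OneParticle s) : Symm s n := symmetrize s n (prodVec f)

/-- The Fock space `⨁ₙ 𝓕ₙ` (Hilbert sum). -/
def Fock (s : ℕ) : Type := lp (fun n => Symm s n) 2

instance (s : ℕ) : NormedAddCommGroup (Fock s) :=
  inferInstanceAs (NormedAddCommGroup (lp (fun n => Symm s n) 2))

instance (s : ℕ) : InnerProductSpace ℂ (Fock s) :=
  inferInstanceAs (InnerProductSpace ℂ (lp (fun n => Symm s n) 2))

instance (s : ℕ) : CompleteSpace (Fock s) :=
  inferInstanceAs (CompleteSpace (lp (fun n => Symm s n) 2))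

/-- The inclusion of the `n`-particle space into Fock space. -/
def incl (s n : ℕ) : Symm s n →L[ℂ] Fock s :=
  lp.singleContinuousLinearMap ℂ (fun n => Symm s n) 2 n

/-- The `n`-particle component of a vector in Fock space. -/
def component (s n : ℕ) : Fock s →L[ℂ] Symm s n :=
  lp.evalCLM ℂ (fun n => Symm s n) 2 n

/-! ### Fields, resolvents and the resolvent algebra -/

theorem measurePreserving_head (s n : ℕ) :
    MeasurePreserving (fun x : Fin (n + 1) → Space s => (x 0, fun i : Fin n => x i.succ))
      volume (volume.prod volume) :=
  volume_preserving_piFinSuccAbove (fun _ : Fin (n + 1) => Space s) 0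

/-- The creation operator `a*(f) : 𝓕ₙ → 𝓕ₙ₊₁`, `a*(f) ψ = √(n+1) · f ⊗ₛ ψ`. -/
def create {s : ℕ} (f : OneParticle s) (n : ℕ) : Symm s n →L[ℂ] Symm s (n + 1) :=
  ((Real.sqrt (n + 1) : ℝ) : ℂ) •
    (symmetrize s (n + 1) ∘L tensorL (measurePreserving_head s n) f ∘L symmIncl s n)

/-- The annihilation operator `a(f) : 𝓕ₙ₊₁ → 𝓕ₙ`, the adjoint of the creation operator. -/
def annihilate {s : ℕ} (f : OneParticle s) (n : ℕ) : Symm s (n + 1) →L[ℂ] Symm s n :=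
  ContinuousLinearMap.adjoint (create f n)

/-- The graph of `a*(f) + a(f)` on the domain of vectors with finitely many particles. -/
def fieldGraph₀ {s : ℕ} (f : OneParticle s) : Set (Fock s × Fock s) :=
  {q | (∃ N, ∀ n, N ≤ n → component s n q.1 = 0) ∧
    component s 0 q.2 = annihilate f 0 (component s 1 q.1) ∧
    ∀ n, component s (n + 1) q.2 =
      create f n (component s n q.1) + annihilate f (n + 1) (component s (n + 2) q.1)}

/-- The graph of the selfadjoint field operator `φ(f)`, the closure of `a*(f) + a(f)` on the
domain of vectors with finitely many particles. -/
def fieldGraph {s : ℕ} (f : OneParticle s) : Set (Fock s × Fock s) := closure (fieldGraph₀ f)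

/-- `R = (iλ + φ(f))⁻¹`: one has `R χ = ψ` if and only if `ψ` is in the domain of `φ(f)` and
`(iλ + φ(f)) ψ = χ`. -/
def IsResolvent {s : ℕ} (lam : ℝ) (f : OneParticle s) (R : Fock s →L[ℂ] Fock s) : Prop :=
  ∀ χ ψ, R χ = ψ ↔ (ψ, χ - (Complex.I * lam) • ψ) ∈ fieldGraph f

/-- The test functions `𝓓(ℝˢ)`: smooth complex functions with compact support. -/
abbrev Test (s : ℕ) : Type := 𝓓((⊤ : TopologicalSpace.Opens (Space s)), ℂ)

/-- The class of a test function in `L²(ℝˢ)`. -/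
def Test.toL2 {s : ℕ} (f : Test s) : OneParticle s :=
  (f.continuous.memLp_of_hasCompactSupport f.hasCompactSupport :
    MemLp (f : Space s → ℂ) 2 volume).toLp _

/-- The resolvent algebra in the Fock representation: the norm closure of the algebra of sums and
products of resolvents of the fields. (It is stable under adjoints since
`R(λ, f)* = R(-λ, f)`.) -/
def resolventAlgebra (s : ℕ) : Subalgebra ℂ (Fock s →L[ℂ] Fock s) :=
  (Algebra.adjoin ℂ {R | ∃ (lam : ℝ) (f : Test s), lam ≠ 0 ∧
    IsResolvent lam f.toL2 R}).topologicalClosure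

/-- The gauge transformation `e^{itN}`, acting on `𝓕ₙ` as multiplication by `e^{itn}`. -/
def gauge (s : ℕ) (t : ℝ) : Fock s →L[ℂ] Fock s :=
  diag (G := fun n => Symm s n) (fun n => Complex.exp (Complex.I * t * n) • ContinuousLinearMap.id ℂ (Symm s n))
    (K := 1) (fun n => by
      refine (norm_smul_le _ _).trans ?_
      have h : Complex.I * t * n = ((t * n : ℝ) : ℂ) * Complex.I := by push_cast; ring
      rw [h, Complex.norm_exp_ofReal_mul_I, one_mul]
      exact ContinuousLinearMap.norm_id_le)

/-- The algebra of gauge invariant elements of the resolvent algebra: those `A` with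
`e^{itN} A e^{-itN} = A` for all `t`. -/
def gaugeInvariantAlgebra (s : ℕ) : Subalgebra ℂ (Fock s →L[ℂ] Fock s) :=
  resolventAlgebra s ⊓ Subalgebra.centralizer ℂ (Set.range (gauge s))

/-- The restriction `A ↾ 𝓕ₙ`. -/
def restrict {s : ℕ} (A : Fock s →L[ℂ] Fock s) (n : ℕ) : Symm s n →L[ℂ] Fock s :=
  A ∘L incl s n

/-! ### The operators `C ⊗ₛ 1 ⊗ₛ ⋯ ⊗ₛ 1` -/

theorem measurePreserving_split (s : ℕ) {m n : ℕ} (h : m ≤ n) :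
    MeasurePreserving (fun x : Fin n → Space s => ((fun i : Fin m => x (Fin.castLE h i)),
      (fun j : Fin (n - m) => x ⟨m + j, by omega⟩))) volume (volume.prod volume) := by
  let e : Fin m ⊕ Fin (n - m) ≃ Fin n := finSumFinEquiv.trans (finCongr (by omega))
  have h1 := (volume_measurePreserving_piCongrLeft (fun _ => Space s) e).symm
  have h2 := volume_measurePreserving_sumPiEquivProdPi (fun _ : Fin m ⊕ Fin (n - m) => Space s)
  exact h2.comp h1

/-- For an operator `C` on `𝓕ₘ` and `m ≤ n`, the operator `C ⊗ₛ 1 ⊗ₛ ⋯ ⊗ₛ 1` on `𝓕ₙ` with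
`n - m` factors `1`: the operator `C` (extended by `0` to the orthogonal complement of `𝓕ₘ` in the
unsymmetrized space) is tensored with the identity, and the result is symmetrized. -/
def ampl {s m n : ℕ} (h : m ≤ n) (C : Symm s m →L[ℂ] Symm s m) : Symm s n →L[ℂ] Symm s n :=
  symmetrize s n ∘L
    tensorOne (measurePreserving_split s h) (symmIncl s m ∘L C ∘L symmetrize s m) ∘L symmIncl s n

/-- The translate `e^{ixP} f`, `(e^{ixP} f)(y) = f(y + x)`, of a wave function. -/
def translate {s : ℕ} (x : Space s) (f : OneParticle s) : OneParticle s :=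
  Lp.compMeasurePreserving (fun y => y + x) (measurePreserving_add_right volume x) f

/-- The vector `f₁ ⊗ₛ ⋯ ⊗ₛ fₖ ⊗ₛ fₖ₊₁(x)` in Fock space, whose last factor is translated by `x`. -/
def farVec {s k : ℕ} (f : Fin (k + 1) → Test s) (x : Space s) : Fock s :=
  incl s (k + 1) (symmVec (Fin.snoc (fun i : Fin k => (f i.castSucc).toL2)
    (translate x (f (Fin.last k)).toL2)))

/-- The vector `f₁ ⊗ₛ ⋯ ⊗ₛ fₖ` in Fock space (the vacuum if `k = 0`), in which the last of the
functions `f₁, …, fₖ₊₁` is omitted. -/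
def nearVec {s k : ℕ} (f : Fin (k + 1) → Test s) : Fock s :=
  incl s k (symmVec (fun i : Fin k => (f i.castSucc).toL2))

end Fock

end BoseResolvent

end

open BoseResolvent

/-! A particle carried to infinity decouples from every element of the resolvent algebra. Let `h` be
a one-particle state and let P be the projection onto the vectors without particles in the state
`h`. The operator a*(h)P (`excite h`) is bounded, and the canonical commutation relations show that
it commutes with every resolvent of a field φ(f) with f orthogonal to `h`. A polynomial in
resolvents involves only finitely many test functions, and a translated test function f(x) is
orthogonal to all of them once x is large. Such a polynomial A therefore satisfies ⟨a*(g(x))Ψ, A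
a*(f(x))Φ⟩ = ⟨g,f⟩⟨Ψ,AΦ⟩ exactly for large x, provided Φ and Ψ are symmetric products of test
functions (`eventually_inner_create_testVec`). Uniform bounds extend this, as a limit, to the norm
closure and to all Φ, Ψ (`tendsto_inner_create`).

The three claims follow. The limit of matrix elements is this formula with a*(f) normalized: each
side contributes a factor 1/√n. For the norms, gauge invariance gives AΦ ∈ 𝓕ₖ, so Ψ = AΦ may be
inserted and the left side estimated by the norm of A on 𝓕ₖ₊₁.

For the third claim, expand a*(f(x))Φ according to the slot occupied by f(x). If this slot is one of
the m on which the compact operator Cₘ acts, the term tends to 0 in norm, because translates tend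
weakly to 0 and compact operators make this convergence strong. In each of the other n - m slots
f(x) is a spectator. Hence Cₘ,ₙ acts asymptotically as (n - m)/n times Cₘ,ₙ₋₁
(`tendsto_ampl_create_sub`), and comparison with the limit formula determines A on 𝓕ₙ₋₁. -/

noncomputable section

namespace BoseResolvent

/-! ### Product vectors -/

section Products

variable {s n : ℕ}

theorem ae_forall_eval {P : Fin n → Space s → Prop} (h : ∀ i, ∀ᵐ y, P i y) :
    ∀ᵐ x : Fin n → Space s, ∀ i, P i (x i) :=
  ae_all_iff.2 fun i => (Measure.quasiMeasurePreserving_eval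
    (fun _ : Fin n => (volume : Measure (Space s))) i).ae (h i)

theorem coeFn_prodVec (f : Fin n → OneParticle s) :
    prodVec f =ᵐ[volume] fun x => ∏ i, f i (x i) :=
  (memLp_prodVec f).coeFn_toLp

theorem prodVec_eq_of_ae {f : Fin n → OneParticle s} {ψ : Unsymm s n}
    (h : ψ =ᵐ[volume] fun x => ∏ i, f i (x i)) : ψ = prodVec f :=
  Lp.ext (h.trans (coeFn_prodVec f).symm)

theorem inner_prodVec (f g : Fin n → OneParticle s) :
    ⟪prodVec f, prodVec g⟫_ℂ = ∏ i, ⟪f i, g i⟫_ℂ := by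
  have h1 : ⟪prodVec f, prodVec g⟫_ℂ = ∫ x : Fin n → Space s, ∏ i, ⟪f i (x i), g i (x i)⟫_ℂ := by
    rw [MeasureTheory.L2.inner_def]
    refine integral_congr_ae ?_
    filter_upwards [coeFn_prodVec f, coeFn_prodVec g] with x h1 h2
    simp only [h1, h2, RCLike.inner_apply, map_prod, Finset.prod_mul_distrib]
  rw [h1, integral_fintype_prod_volume_eq_prod (fun i y => ⟪f i y, g i y⟫_ℂ)]
  rfl

theorem norm_prodVec (f : Fin n → OneParticle s) : ‖prodVec f‖ = ∏ i, ‖f i‖ := by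
  have h : (‖prodVec f‖ : ℂ) ^ 2 = ((∏ i, ‖f i‖ : ℝ) : ℂ) ^ 2 := by
    have h1 := inner_prodVec f f
    simp only [inner_self_eq_norm_sq_to_K] at h1
    push_cast
    rw [← Finset.prod_pow]
    exact h1
  have h' : ‖prodVec f‖ ^ 2 = (∏ i, ‖f i‖) ^ 2 := by exact_mod_cast h
  exact (pow_left_inj₀ (norm_nonneg _) (Finset.prod_nonneg fun _ _ => norm_nonneg _)
    two_ne_zero).1 h'

theorem prod_update_apply (f : Fin n → OneParticle s) (i : Fin n) (c : OneParticle s)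
    (x : Fin n → Space s) : ∏ j, (Function.update f i c j) (x j) =
      c (x i) * ∏ j ∈ Finset.univ.erase i, f j (x j) := by
  rw [← Finset.mul_prod_erase _ _ (Finset.mem_univ i), Function.update_self]
  congr 1
  refine Finset.prod_congr rfl fun j hj => ?_
  rw [Function.update_of_ne (Finset.ne_of_mem_erase hj)]

/-- The product vector as a bounded multilinear map of its factors. -/
def prodVecL (s n : ℕ) : ContinuousMultilinearMap ℂ (fun _ : Fin n => OneParticle s) (Unsymm s n) :=
  MultilinearMap.mkContinuous
    { toFun := prodVec
      map_update_add' := fun {inst} f i a b => by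
        -- Multilinearity is required for an arbitrary decidable equality of indices; it is
        -- identified with the standard one, for which `prod_update_apply` is stated.
        obtain rfl := Subsingleton.elim inst (instDecidableEqFin n)
        apply Lp.ext
        filter_upwards [coeFn_prodVec (Function.update f i (a + b)),
          coeFn_prodVec (Function.update f i a), coeFn_prodVec (Function.update f i b),
          Lp.coeFn_add (prodVec (Function.update f i a)) (prodVec (Function.update f i b)),
          ae_forall_eval (fun _ : Fin n => Lp.coeFn_add a b)] with x h1 h2 h3 h4 h5
        refine (h1.trans ?_).trans h4.symm
        rw [Pi.add_apply, h2, h3, prod_update_apply, prod_update_apply, prod_update_apply, h5 i,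
          Pi.add_apply, add_mul]
      map_update_smul' := fun {inst} f i c a => by
        obtain rfl := Subsingleton.elim inst (instDecidableEqFin n)
        apply Lp.ext
        filter_upwards [coeFn_prodVec (Function.update f i (c • a)),
          coeFn_prodVec (Function.update f i a),
          Lp.coeFn_smul c (prodVec (Function.update f i a)),
          ae_forall_eval (fun _ : Fin n => Lp.coeFn_smul c a)] with x h1 h2 h3 h4
        refine (h1.trans ?_).trans h3.symm
        rw [Pi.smul_apply, h2, prod_update_apply, prod_update_apply, h4 i, Pi.smul_apply,
          smul_eq_mul, smul_eq_mul, mul_assoc] }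
    1 (fun f => by rw [one_mul]; exact (norm_prodVec f).le)

/-- Since the factors are composed with π, the map π ↦ U(π) reverses products; this fixes the order
of permutations in all later computations. -/
theorem permL_prodVec (π : Equiv.Perm (Fin n)) (f : Fin n → OneParticle s) :
    permL s n π (prodVec f) = prodVec (f ∘ π) := by
  refine prodVec_eq_of_ae ?_
  have hπ := measurePreserving_perm s n π
  refine (Lp.coeFn_compMeasurePreserving (prodVec f) hπ).trans ?_
  filter_upwards [hπ.quasiMeasurePreserving.ae_eq_comp (coeFn_prodVec f)] with x hx
  rw [hx, Function.comp_apply]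
  exact Fintype.prod_equiv π.symm _ _ fun i => by simp

theorem tensor_head_prodVec (f : OneParticle s) (g : Fin n → OneParticle s) :
    tensor (measurePreserving_head s n) f (prodVec g) = prodVec (Fin.cons f g : Fin (n + 1) → _) := by
  refine prodVec_eq_of_ae ?_
  filter_upwards [coeFn_tensor (measurePreserving_head s n) f (prodVec g),
    ae_snd (measurePreserving_head s n) (coeFn_prodVec g)] with x h1 h2
  rw [h1, h2, Fin.prod_univ_succ]
  simp

theorem tensor_split_prodVec {m : ℕ} (h : m ≤ n) (f : Fin n → OneParticle s) :
    tensor (measurePreserving_split s h) (prodVec fun i : Fin m => f (Fin.castLE h i))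
      (prodVec fun j : Fin (n - m) => f ⟨m + j, by omega⟩) = prodVec f := by
  refine prodVec_eq_of_ae ?_
  filter_upwards [coeFn_tensor (measurePreserving_split s h)
      (prodVec fun i : Fin m => f (Fin.castLE h i))
      (prodVec fun j : Fin (n - m) => f ⟨m + j, by omega⟩),
    ae_fst (measurePreserving_split s h) (coeFn_prodVec fun i : Fin m => f (Fin.castLE h i)),
    ae_snd (measurePreserving_split s h)
      (coeFn_prodVec fun j : Fin (n - m) => f ⟨m + j, by omega⟩)] with x h1 h2 h3
  rw [h1, h2, h3]
  let e : Fin m ⊕ Fin (n - m) ≃ Fin n := finSumFinEquiv.trans (finCongr (by omega))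
  rw [← Fintype.prod_equiv e (fun i => f (e i) (x (e i))) _ (fun _ => rfl), Fintype.prod_sum_type]
  rfl

theorem prodVec_indicator {t : Fin n → Set (Space s)} (ht : ∀ i, MeasurableSet (t i))
    (hμ : ∀ i, volume (t i) ≠ ⊤) (hv : volume (Set.univ.pi t) ≠ ⊤) :
    prodVec (fun i => indicatorConstLp 2 (ht i) (hμ i) (1 : ℂ)) =
      indicatorConstLp 2 (MeasurableSet.univ_pi ht) hv (1 : ℂ) := by
  symm
  refine prodVec_eq_of_ae ?_
  filter_upwards [indicatorConstLp_coeFn (p := 2) (hs := MeasurableSet.univ_pi ht) (hμs := hv)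
      (c := (1 : ℂ)),
    ae_forall_eval (fun i => indicatorConstLp_coeFn (p := 2) (hs := ht i) (hμs := hμ i)
      (c := (1 : ℂ)))] with x h1 h2
  rw [h1, Finset.prod_congr rfl fun i _ => h2 i]
  by_cases hx : x ∈ Set.univ.pi t
  · rw [Set.indicator_of_mem hx]
    exact (Finset.prod_eq_one fun i _ => Set.indicator_of_mem (hx i trivial) _).symm
  · rw [Set.indicator_of_notMem hx]
    obtain ⟨i, hi⟩ : ∃ i, x i ∉ t i := by simpa using hx
    exact (Finset.prod_eq_zero (Finset.mem_univ i) (Set.indicator_of_notMem hi _)).symm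

/-- Indicators of boxes are product vectors, so the integrals of ψ over bounded boxes vanish. Boxes
form a π-system generating the product σ-algebra, and Dynkin's theorem gives the same for all
measurable sets. The cutoff to the cubes `B N` provides finite measure and integrability. -/
theorem eq_zero_of_inner_prodVec {ψ : Unsymm s n} (h : ∀ f, ⟪prodVec f, ψ⟫_ℂ = 0) : ψ = 0 := by
  let S : ℕ → Set (Space s) := fun N => Metric.closedBall 0 N
  have hS : ∀ N, volume (S N) < ⊤ := fun N => measure_closedBall_lt_top
  let B : ℕ → Set (Fin n → Space s) := fun N => Set.univ.pi fun _ => S N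
  have hB : ∀ t : Fin n → Set (Space s), (∀ i, volume (t i) < ⊤) →
      volume (Set.univ.pi t) < ⊤ := by
    intro t ht
    rw [volume_pi_pi]
    exact ENNReal.prod_lt_top fun i _ => ht i
  have hBm : ∀ N, MeasurableSet (B N) := fun N =>
    MeasurableSet.univ_pi fun _ => measurableSet_closedBall
  have hBU : ⋃ N, B N = Set.univ := by
    refine Set.eq_univ_of_forall fun x => ?_
    obtain ⟨N, hN⟩ := exists_nat_ge (∑ i, ‖x i‖)
    refine Set.mem_iUnion.2 ⟨N, fun i _ => ?_⟩
    rw [mem_closedBall_zero_iff]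
    exact (Finset.single_le_sum (f := fun i => ‖x i‖) (fun _ _ => norm_nonneg _)
      (Finset.mem_univ i)).trans hN
  have hint : ∀ N, IntegrableOn ψ (B N) := fun N =>
    integrableOn_Lp_of_measure_ne_top ψ (by norm_num) (hB _ fun _ => hS N).ne
  have key : ∀ N (t : Set (Fin n → Space s)), MeasurableSet t → ∫ x in t ∩ B N, ψ x = 0 := by
    intro N t ht
    -- The whole cube is needed for the complement step of the induction.
    have hu : ∫ x in B N, ψ x = 0 := by
      have := h fun _ => indicatorConstLp 2 measurableSet_closedBall (hS N).ne (1 : ℂ)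
      rwa [prodVec_indicator _ _ (hB _ fun _ => hS N).ne, L2.inner_indicatorConstLp_one] at this
    induction t, ht using MeasurableSpace.induction_on_inter
      (generateFrom_pi (α := fun _ : Fin n => Space s)).symm isPiSystem_pi with
    | empty => simp
    | basic t ht =>
      obtain ⟨u, hu, rfl⟩ := ht
      have hum : ∀ i, MeasurableSet (u i ∩ S N) := fun i =>
        MeasurableSet.inter (hu i trivial : MeasurableSet (u i)) measurableSet_closedBall
      have huf : ∀ i, volume (u i ∩ S N) < ⊤ := fun i =>
        (measure_mono Set.inter_subset_right).trans_lt (hS N)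
      have := h fun i => indicatorConstLp 2 (hum i) (huf i).ne (1 : ℂ)
      rw [prodVec_indicator _ _ (hB _ huf).ne, L2.inner_indicatorConstLp_one] at this
      rwa [← Set.pi_inter_distrib]
    | compl t ht ih =>
      have h1 := integral_inter_add_sdiff (f := ψ) ht (hint N)
      rw [hu, Set.inter_comm, ih, zero_add] at h1
      rwa [Set.inter_comm, ← Set.sdiff_eq]
    | iUnion t hd ht ih =>
      rw [Set.iUnion_inter, integral_iUnion (fun i => (ht i).inter (hBm N))
        (fun i j hij => (hd hij).mono Set.inter_subset_left Set.inter_subset_left)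
        ((hint N).mono_set (Set.iUnion_subset fun _ => Set.inter_subset_right))]
      simp [ih]
  refine Lp.ext (EventuallyEq.trans ?_ (Lp.coeFn_zero ℂ 2 _).symm)
  have h2 : ∀ᵐ x ∂(volume.restrict (⋃ N, B N)), ψ x = 0 := by
    refine (ae_restrict_iUnion_iff _ _).2 fun N => ?_
    refine Integrable.ae_eq_zero_of_forall_setIntegral_eq_zero (hint N) fun t ht _ => ?_
    rw [Measure.restrict_restrict ht]
    exact key N t ht
  rwa [hBU, Measure.restrict_univ] at h2

theorem span_range_prodVec (s n : ℕ) :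
    (Submodule.span ℂ (Set.range (prodVec (s := s) (n := n)))).topologicalClosure = ⊤ := by
  rw [Submodule.topologicalClosure_eq_top_iff, Submodule.eq_bot_iff]
  intro ψ hψ
  refine eq_zero_of_inner_prodVec fun f => ?_
  exact (Submodule.mem_orthogonal _ _).1 hψ _ (Submodule.subset_span ⟨f, rfl⟩)

end Products

/-! ### Test functions -/

section Tests

variable {s : ℕ}

theorem Test.coeFn_toL2 (f : Test s) : f.toL2 =ᵐ[volume] f := MemLp.coeFn_toLp _

theorem denseRange_toL2 (s : ℕ) : DenseRange (Test.toL2 (s := s)) := by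
  intro f
  refine (mem_closure_iff_nhds_basis Metric.nhds_basis_closedBall).2 fun ε hε => ?_
  obtain ⟨g, hg₁, hg₂, hg₃⟩ := MemLp.exist_eLpNorm_sub_le (p := 2) (by norm_num)
    (by norm_num) (Lp.memLp f) hε
  let G : Test s := ⟨g, hg₂, hg₁, fun _ _ => trivial⟩
  refine ⟨G.toL2, ⟨G, rfl⟩, ?_⟩
  have : (f : Space s → ℂ) - (G.toL2 : Space s → ℂ) =ᵐ[volume] (f : Space s → ℂ) - g := by
    filter_upwards [G.coeFn_toL2] with x hx
    rw [Pi.sub_apply, Pi.sub_apply, hx]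
    rfl
  rw [Metric.mem_closedBall', Lp.dist_def, eLpNorm_congr_ae this]
  exact ENNReal.toReal_le_of_le_ofReal hε.le hg₃

/-- Supplies the probe particle that is sent to infinity; the factor ⟨f,f⟩ has to be cancelled from
the limits. -/
theorem exists_toL2_ne_zero (s : ℕ) : ∃ f : Test s, f.toL2 ≠ 0 := by
  by_contra! h
  have : (indicatorConstLp 2 (μ := (volume : Measure (Space s))) (s := Metric.closedBall 0 1)
      measurableSet_closedBall measure_closedBall_lt_top.ne (1 : ℂ)) = 0 := by
    have h1 := (denseRange_toL2 s) (indicatorConstLp 2 (μ := (volume : Measure (Space s)))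
      (s := Metric.closedBall 0 1) measurableSet_closedBall measure_closedBall_lt_top.ne (1 : ℂ))
    have h2 : Set.range (Test.toL2 (s := s)) ⊆ {0} := by
      rintro _ ⟨a, rfl⟩
      exact h a
    simpa using closure_mono h2 h1
  have h2 := congrArg norm this
  rw [norm_indicatorConstLp (by norm_num) (by norm_num), norm_zero, norm_one, one_mul] at h2
  have h3 : 0 < (volume : Measure (Space s)).real (Metric.closedBall 0 1) :=
    ENNReal.toReal_pos (Metric.measure_closedBall_pos _ _ one_pos).ne'
      measure_closedBall_lt_top.ne
  exact (Real.rpow_pos_of_pos h3 _).ne' h2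

theorem span_range_prodVec_toL2 (s n : ℕ) :
    (Submodule.span ℂ (Set.range fun f : Fin n → Test s =>
      prodVec fun i => (f i).toL2)).topologicalClosure = ⊤ := by
  have hd := DenseRange.piMap (fun _ : Fin n => denseRange_toL2 s)
  rw [eq_top_iff, ← span_range_prodVec s n]
  refine Submodule.topologicalClosure_minimal _ (Submodule.span_le.2 ?_)
    (Submodule.isClosed_topologicalClosure _)
  rintro _ ⟨f, rfl⟩
  have h1 := image_closure_subset_closure_image (prodVecL s n).cont
    (Set.mem_image_of_mem _ (hd f))
  refine closure_mono ?_ h1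
  rintro _ ⟨_, ⟨g, rfl⟩, rfl⟩
  exact Submodule.subset_span ⟨g, rfl⟩

end Tests

/-! ### Symmetrization and contractions -/

section Symmetrization

variable {s n : ℕ}

/-- The tool by which operator identities on the unsymmetrized space are reduced to combinatorics of
factors. -/
theorem ext_prodVec {E : Type*} [NormedAddCommGroup E] [NormedSpace ℂ E]
    {T T' : Unsymm s n →L[ℂ] E} (h : ∀ f, T (prodVec f) = T' (prodVec f)) : T = T' :=
  ContinuousLinearMap.ext_on
    (Submodule.dense_iff_topologicalClosure_eq_top.2 (span_range_prodVec s n))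
    (by rintro _ ⟨f, rfl⟩; exact h f)

theorem eq_of_inner_prodVec {ψ χ : Unsymm s n} (h : ∀ f, ⟪prodVec f, ψ⟫_ℂ = ⟪prodVec f, χ⟫_ℂ) :
    ψ = χ :=
  sub_eq_zero.1 (eq_zero_of_inner_prodVec fun f => by rw [inner_sub_right, h f, sub_self])

theorem permL_refl (ψ : Unsymm s n) : permL s n (Equiv.refl _) ψ = ψ := by
  have h : (permL s n (Equiv.refl _)).toContinuousLinearMap = ContinuousLinearMap.id ℂ _ :=
    ext_prodVec fun f => permL_prodVec _ f
  exact congrArg (fun T => T ψ) h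

theorem permL_symm (π : Equiv.Perm (Fin n)) (ψ : Symm s n) :
    permL s n π (ψ : Unsymm s n) = ψ := ψ.2 π

theorem coe_symmetrize (ψ : Unsymm s n) :
    (symmetrize s n ψ : Unsymm s n) = (n.factorial : ℂ)⁻¹ • ∑ π, permL s n π ψ := by
  change ((n.factorial : ℂ)⁻¹ • ∑ π : Equiv.Perm (Fin n),
    (permL s n π).toContinuousLinearMap) ψ = _
  simp

theorem symmetrize_permL (π : Equiv.Perm (Fin n)) (ψ : Unsymm s n) :
    symmetrize s n (permL s n π ψ) = symmetrize s n ψ := by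
  apply Subtype.ext
  rw [coe_symmetrize, coe_symmetrize]
  congr 1
  refine Fintype.sum_equiv (Equiv.mulLeft π) _ _ fun τ => ?_
  rw [permL_permL]
  rfl

/-- Each U(π) is isometric and fixes Φ, so all terms of the mean have the same inner product with Φ.
-/
theorem inner_symmetrize (Φ : Symm s n) (χ : Unsymm s n) :
    ⟪Φ, symmetrize s n χ⟫_ℂ = ⟪(Φ : Unsymm s n), χ⟫_ℂ := by
  have h : ∀ π, ⟪(Φ : Unsymm s n), permL s n π χ⟫_ℂ = ⟪(Φ : Unsymm s n), χ⟫_ℂ := fun π => by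
    conv_lhs => rw [← permL_symm π Φ]
    exact (permL s n π).inner_map_map _ _
  rw [Submodule.coe_inner, coe_symmetrize, inner_smul_right, inner_sum]
  simp only [h, Finset.sum_const, Finset.card_univ, Fintype.card_perm, Fintype.card_fin,
    nsmul_eq_mul]
  rw [inv_mul_cancel_left₀ (by exact_mod_cast n.factorial_ne_zero)]

theorem symmetrize_coe (Φ : Symm s n) : symmetrize s n (Φ : Unsymm s n) = Φ :=
  ext_inner_left ℂ fun Ψ => inner_symmetrize Ψ _

theorem norm_symmetrize_le (ψ : Unsymm s n) : ‖symmetrize s n ψ‖ ≤ ‖ψ‖ := by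
  have h1 := inner_symmetrize (symmetrize s n ψ) ψ
  have h2 : ‖symmetrize s n ψ‖ ^ 2 ≤ ‖symmetrize s n ψ‖ * ‖ψ‖ := by
    have h3 := norm_inner_le_norm (𝕜 := ℂ) (symmetrize s n ψ : Unsymm s n) ψ
    rw [← h1, inner_self_eq_norm_sq_to_K (𝕜 := ℂ) (symmetrize s n ψ)] at h3
    simpa using h3
  rcases (norm_nonneg (symmetrize s n ψ)).eq_or_lt with h | h
  · rw [← h]
    exact norm_nonneg _
  · rw [sq] at h2
    exact le_of_mul_le_mul_left h2 h

/-- A permutation of `{1, …, n}`, acting on `{0, 1, …, n}` with fixed point `0`. -/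
def shiftPerm (e : Equiv.Perm (Fin n)) : Equiv.Perm (Fin (n + 1)) :=
  Equiv.Perm.decomposeFin.symm (0, e)

theorem shiftPerm_zero (e : Equiv.Perm (Fin n)) : shiftPerm e 0 = 0 :=
  Equiv.Perm.decomposeFin_symm_apply_zero _ _

theorem shiftPerm_succ (e : Equiv.Perm (Fin n)) (i : Fin n) : shiftPerm e i.succ = (e i).succ := by
  rw [shiftPerm, Equiv.Perm.decomposeFin_symm_apply_succ, Equiv.swap_self, Equiv.refl_apply]

/-- The vector `f ⊗ ψ`. -/
abbrev tensorHead (f : OneParticle s) : Unsymm s n →L[ℂ] Unsymm s (n + 1) :=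
  tensorL (measurePreserving_head s n) f

theorem tensorHead_prodVec (f : OneParticle s) (g : Fin n → OneParticle s) :
    tensorHead f (prodVec g) = prodVec (Fin.cons f g : Fin (n + 1) → _) :=
  tensor_head_prodVec f g

theorem norm_tensorHead (f : OneParticle s) (ψ : Unsymm s n) : ‖tensorHead f ψ‖ = ‖f‖ * ‖ψ‖ :=
  norm_tensor (measurePreserving_head s n) f ψ

theorem permL_shiftPerm_tensorHead (e : Equiv.Perm (Fin n)) (f : OneParticle s)
    (ψ : Unsymm s n) : permL s (n + 1) (shiftPerm e) (tensorHead f ψ) =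
      tensorHead f (permL s n e ψ) := by
  have h : (permL s (n + 1) (shiftPerm e)).toContinuousLinearMap ∘L tensorHead f =
      tensorHead f ∘L (permL s n e).toContinuousLinearMap := by
    refine ext_prodVec fun g => ?_
    change permL s (n + 1) (shiftPerm e) (tensorHead f (prodVec g)) =
      tensorHead f (permL s n e (prodVec g))
    rw [tensorHead_prodVec, permL_prodVec, permL_prodVec, tensorHead_prodVec]
    congr 1
    funext i
    refine Fin.cases ?_ (fun i => ?_) i
    · simp [shiftPerm_zero]
    · simp [shiftPerm_succ]
  exact congrArg (fun T => T ψ) h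

theorem decomposeFin_symm_eq (p : Fin (n + 1)) (e : Equiv.Perm (Fin n)) :
    Equiv.Perm.decomposeFin.symm (p, e) = Equiv.swap 0 p * shiftPerm e := by
  ext i
  refine Fin.cases ?_ (fun i => ?_) i
  · simp [shiftPerm_zero]
  · simp [shiftPerm_succ]

/-- The permutations fixing 0 leave f ⊗ ψ invariant, as ψ is symmetric. The mean over all
permutations collapses to the n + 1 cosets of this stabilizer, which are represented by the
transpositions of 0 and p. -/
theorem coe_symmetrize_tensorHead (f : OneParticle s) (ψ : Symm s n) :
    (symmetrize s (n + 1) (tensorHead f (ψ : Unsymm s n)) : Unsymm s (n + 1)) =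
      ((n + 1 : ℕ) : ℂ)⁻¹ • ∑ p, permL s (n + 1) (Equiv.swap 0 p) (tensorHead f ψ) := by
  -- Summing over inverses makes the stabilizer act first on the vector, because U reverses
  -- products.
  rw [coe_symmetrize, ← Equiv.sum_comp (Equiv.inv (Equiv.Perm (Fin (n + 1)))),
    ← Equiv.sum_comp Equiv.Perm.decomposeFin.symm, Fintype.sum_prod_type]
  have h : ∀ (p : Fin (n + 1)) (e : Equiv.Perm (Fin n)),
      permL s (n + 1) (Equiv.inv _ (Equiv.Perm.decomposeFin.symm (p, e))) (tensorHead f ψ) =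
        permL s (n + 1) (Equiv.swap 0 p) (tensorHead f ψ) := by
    intro p e
    have h1 : tensorHead f (ψ : Unsymm s n) =
        permL s (n + 1) (shiftPerm e) (tensorHead f ψ) := by
      rw [permL_shiftPerm_tensorHead, permL_symm]
    conv_lhs => rw [h1]
    rw [permL_permL, decomposeFin_symm_eq, Equiv.inv_apply, mul_inv_rev, mul_inv_cancel_left,
      Equiv.swap_inv]
  simp only [h, Finset.sum_const, Finset.card_univ, Fintype.card_perm, Fintype.card_fin]
  rw [← Finset.smul_sum, ← Nat.cast_smul_eq_nsmul ℂ, smul_smul, Nat.factorial_succ]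
  congr 1
  have := n.factorial_ne_zero
  push_cast
  field_simp

/-- Permutations of the last n variables are absorbed by the outer symmetrization. -/
theorem symmetrize_tensorHead_symmetrize (f : OneParticle s) (χ : Unsymm s n) :
    symmetrize s (n + 1) (tensorHead f (symmetrize s n χ : Unsymm s n)) =
      symmetrize s (n + 1) (tensorHead f χ) := by
  rw [coe_symmetrize, map_smul, map_sum, map_smul, map_sum]
  simp only [← permL_shiftPerm_tensorHead, symmetrize_permL, Finset.sum_const, Finset.card_univ,
    Fintype.card_perm, Fintype.card_fin]
  rw [← Nat.cast_smul_eq_nsmul ℂ, smul_smul,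
    inv_mul_cancel₀ (by exact_mod_cast n.factorial_ne_zero), one_smul]

theorem permL_swap_tensorHead (f h : OneParticle s) (ψ : Unsymm s n) :
    permL s (n + 2) (Equiv.swap 0 1) (tensorHead f (tensorHead h ψ)) =
      tensorHead h (tensorHead f ψ) := by
  have H : (permL s (n + 2) (Equiv.swap 0 1)).toContinuousLinearMap ∘L
      (tensorHead f ∘L tensorHead h) = tensorHead h ∘L tensorHead (n := n) f := by
    refine ext_prodVec fun g => ?_
    change permL s (n + 2) (Equiv.swap 0 1) (tensorHead f (tensorHead h (prodVec g))) =
      tensorHead h (tensorHead f (prodVec g))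
    rw [tensorHead_prodVec, tensorHead_prodVec, tensorHead_prodVec, tensorHead_prodVec,
      permL_prodVec]
    congr 1
    funext i
    refine Fin.cases ?_ (fun i => Fin.cases ?_ (fun i => ?_) i) i
    · rw [Function.comp_apply, Equiv.swap_apply_left]
      rfl
    · rw [Function.comp_apply, Fin.succ_zero_eq_one, Equiv.swap_apply_right]
      rfl
    · rw [Function.comp_apply, Equiv.swap_apply_of_ne_of_ne (Fin.succ_ne_zero _)]
      · rfl
      · rw [← Fin.succ_zero_eq_one, Ne, Fin.succ_inj]
        exact Fin.succ_ne_zero _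
  exact congrArg (fun T => T ψ) H

/-- The contraction of the first variable with `h`, the adjoint of `ψ ↦ h ⊗ ψ`. -/
def contract (h : OneParticle s) : Unsymm s (n + 1) →L[ℂ] Unsymm s n :=
  ContinuousLinearMap.adjoint (tensorHead h)

theorem inner_contract (h : OneParticle s) (χ : Unsymm s n) (ψ : Unsymm s (n + 1)) :
    ⟪χ, contract h ψ⟫_ℂ = ⟪tensorHead h χ, ψ⟫_ℂ :=
  ContinuousLinearMap.adjoint_inner_right _ _ _

theorem contract_prodVec (h : OneParticle s) (g : Fin (n + 1) → OneParticle s) :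
    contract h (prodVec g) = ⟪h, g 0⟫_ℂ • prodVec fun i : Fin n => g i.succ := by
  refine eq_of_inner_prodVec fun f => ?_
  rw [inner_contract, tensorHead_prodVec, inner_prodVec, inner_smul_right, inner_prodVec,
    Fin.prod_univ_succ]
  rfl

theorem contract_tensorHead (h f : OneParticle s) (ψ : Unsymm s n) :
    contract h (tensorHead f ψ) = ⟪h, f⟫_ℂ • ψ := by
  refine eq_of_inner_prodVec fun g => ?_
  rw [inner_contract, inner_smul_right]
  exact inner_tensor (measurePreserving_head s n) _ _ _ _

theorem contract_permL_shiftPerm (h : OneParticle s) (e : Equiv.Perm (Fin n))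
    (ψ : Unsymm s (n + 1)) :
    contract h (permL s (n + 1) (shiftPerm e) ψ) = permL s n e (contract h ψ) := by
  have H : contract h ∘L (permL s (n + 1) (shiftPerm e)).toContinuousLinearMap =
      (permL s n e).toContinuousLinearMap ∘L contract h := by
    refine ext_prodVec fun g => ?_
    change contract h (permL s (n + 1) (shiftPerm e) (prodVec g)) =
      permL s n e (contract h (prodVec g))
    rw [permL_prodVec, contract_prodVec, contract_prodVec, map_smul, permL_prodVec]
    simp only [Function.comp_apply, shiftPerm_zero, shiftPerm_succ]
    rfl
  exact congrArg (fun T => T ψ) H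

theorem contract_swap_tensorHead (h f : OneParticle s) (ψ : Unsymm s (n + 1)) :
    contract h (permL s (n + 2) (Equiv.swap 0 1) (tensorHead f ψ)) =
      tensorHead f (contract h ψ) := by
  have H : contract h ∘L (permL s (n + 2) (Equiv.swap 0 1)).toContinuousLinearMap ∘L
      tensorHead f = tensorHead f ∘L contract h := by
    refine ext_prodVec fun g => ?_
    change contract h (permL s (n + 2) (Equiv.swap 0 1) (tensorHead f (prodVec g))) =
      tensorHead f (contract h (prodVec g))
    rw [← Fin.cons_self_tail g, ← tensorHead_prodVec, permL_swap_tensorHead, contract_tensorHead,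
      contract_tensorHead, map_smul]
  exact congrArg (fun T => T ψ) H

theorem contract_mem (h : OneParticle s) (Φ : Symm s (n + 1)) :
    contract h (Φ : Unsymm s (n + 1)) ∈ Symm s n := fun e => by
  rw [← contract_permL_shiftPerm, permL_symm]

/-- Conjugation of the transposition of 0 and 1 by the involution `shiftPerm (Equiv.swap 0 q)`,
which fixes 0 and takes 1 to q + 1. It reduces contractions in all slots to
`contract_swap_tensorHead`. -/
theorem swap_zero_succ (q : Fin (n + 1)) : (Equiv.swap 0 q.succ : Equiv.Perm (Fin (n + 2))) =
    shiftPerm (Equiv.swap 0 q) * Equiv.swap 0 1 * shiftPerm (Equiv.swap 0 q) := by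
  have h1 : (shiftPerm (Equiv.swap 0 q) : Equiv.Perm (Fin (n + 2))) =
      (shiftPerm (Equiv.swap 0 q))⁻¹ := by
    rw [eq_inv_iff_mul_eq_one]
    ext i
    refine Fin.cases ?_ (fun i => ?_) i
    · simp [shiftPerm_zero]
    · simp [shiftPerm_succ]
  conv_rhs => enter [2]; rw [h1]
  rw [← Equiv.swap_apply_apply]
  rw [shiftPerm_zero, ← Fin.succ_zero_eq_one, shiftPerm_succ, Equiv.swap_apply_left]

/-- The commutation relation before normalization: in one of the n + 2 slots f itself is contracted
with h, and in the other n + 1 the contraction falls on Φ. -/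
theorem contract_symmetrize_tensorHead (h f : OneParticle s) (Φ : Symm s (n + 1)) :
    contract h (symmetrize s (n + 2) (tensorHead f (Φ : Unsymm s (n + 1))) : Unsymm s (n + 2)) =
      ((n + 2 : ℕ) : ℂ)⁻¹ • (⟪h, f⟫_ℂ • (Φ : Unsymm s (n + 1)) + ((n + 1 : ℕ) : ℂ) •
        (symmetrize s (n + 1) (tensorHead f (contract h (Φ : Unsymm s (n + 1)))) :
          Unsymm s (n + 1))) := by
  have h0 := coe_symmetrize_tensorHead f (⟨_, contract_mem h Φ⟩ : Symm s n)
  rw [coe_symmetrize_tensorHead, map_smul, map_sum, Fin.sum_univ_succ]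
  congr 2
  · rw [Equiv.swap_self, permL_refl, contract_tensorHead]
  · rw [h0, smul_smul, mul_inv_cancel₀ (by exact_mod_cast n.succ_ne_zero), one_smul]
    refine Finset.sum_congr rfl fun q _ => ?_
    rw [swap_zero_succ, mul_assoc, ← permL_permL, ← permL_permL, contract_permL_shiftPerm]
    rw [permL_shiftPerm_tensorHead, permL_symm, contract_swap_tensorHead]

/-! ### Creation and annihilation operators and their commutation relations. -/

theorem coe_create (f : OneParticle s) (Φ : Symm s n) :
    create f n Φ = ((Real.sqrt (n + 1) : ℝ) : ℂ) •
      symmetrize s (n + 1) (tensorHead f (Φ : Unsymm s n)) := rfl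

theorem coe_annihilate (h : OneParticle s) (Φ : Symm s (n + 1)) :
    (annihilate h n Φ : Unsymm s n) =
      ((Real.sqrt (n + 1) : ℝ) : ℂ) • contract h (Φ : Unsymm s (n + 1)) := by
  have H : annihilate h n Φ =
      ((Real.sqrt (n + 1) : ℝ) : ℂ) • (⟨_, contract_mem h Φ⟩ : Symm s n) := by
    refine ext_inner_left ℂ fun Ψ => ?_
    rw [annihilate, ContinuousLinearMap.adjoint_inner_right, coe_create, ← inner_conj_symm,
      Submodule.coe_inner, Submodule.coe_smul, inner_smul_right, ← Submodule.coe_inner,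
      inner_symmetrize, Submodule.coe_inner, Submodule.coe_smul, inner_smul_right, inner_contract,
      map_mul, inner_conj_symm, Complex.conj_ofReal]
  rw [H]
  rfl

theorem sqrt_mul_self_cast (n : ℕ) :
    ((Real.sqrt (n + 1) : ℝ) : ℂ) * ((Real.sqrt (n + 1) : ℝ) : ℂ) = ((n + 1 : ℕ) : ℂ) := by
  rw [← Complex.ofReal_mul, Real.mul_self_sqrt (by positivity)]
  push_cast
  rfl

/-- The canonical commutation relations, on the vacuum sector. -/
theorem annihilate_create_zero (h f : OneParticle s) (Φ : Symm s 0) :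
    annihilate h 0 (create f 0 Φ) = ⟪h, f⟫_ℂ • Φ := by
  apply Subtype.ext
  rw [coe_annihilate, coe_create, Submodule.coe_smul, map_smul, smul_smul, sqrt_mul_self_cast,
    coe_symmetrize_tensorHead, Fin.sum_univ_succ, Fin.sum_univ_zero, add_zero]
  rw [Equiv.swap_self, permL_refl, map_smul, contract_tensorHead, smul_smul]
  simp

/-- The canonical commutation relations. -/
theorem annihilate_create (h f : OneParticle s) (Φ : Symm s (n + 1)) :
    annihilate h (n + 1) (create f (n + 1) Φ) =
      ⟪h, f⟫_ℂ • Φ + create f n (annihilate h n Φ) := by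
  apply Subtype.ext
  rw [coe_annihilate, coe_create, Submodule.coe_smul, map_smul, smul_smul, sqrt_mul_self_cast,
    contract_symmetrize_tensorHead, smul_smul,
    mul_inv_cancel₀ (by exact_mod_cast (n + 1).succ_ne_zero),
    one_smul, coe_create, coe_annihilate, map_smul, map_smul, smul_smul, sqrt_mul_self_cast]
  rfl

theorem create_comm (f h : OneParticle s) (Φ : Symm s n) :
    create f (n + 1) (create h n Φ) = create h (n + 1) (create f n Φ) := by
  rw [coe_create, coe_create, coe_create, coe_create]
  simp only [Submodule.coe_smul, map_smul, symmetrize_tensorHead_symmetrize]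
  rw [← permL_swap_tensorHead, symmetrize_permL]

theorem annihilate_comm (f h : OneParticle s) (Φ : Symm s (n + 2)) :
    annihilate f n (annihilate h (n + 1) Φ) = annihilate h n (annihilate f (n + 1) Φ) := by
  refine ext_inner_left ℂ fun Ψ => ?_
  simp only [annihilate, ContinuousLinearMap.adjoint_inner_right]
  rw [create_comm]

theorem inner_create_left (f : OneParticle s) (Φ : Symm s n) (Ψ : Symm s (n + 1)) :
    ⟪create f n Φ, Ψ⟫_ℂ = ⟪Φ, annihilate f n Ψ⟫_ℂ :=
  (ContinuousLinearMap.adjoint_inner_right _ _ _).symm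

theorem norm_create_le (f : OneParticle s) (n : ℕ) : ‖create f n‖ ≤ Real.sqrt (n + 1) * ‖f‖ := by
  refine ContinuousLinearMap.opNorm_le_bound _ (by positivity) fun Φ => ?_
  rw [coe_create, norm_smul, Complex.norm_real, Real.norm_of_nonneg (Real.sqrt_nonneg _), mul_assoc]
  refine mul_le_mul_of_nonneg_left ?_ (Real.sqrt_nonneg _)
  exact (norm_symmetrize_le _).trans (norm_tensorHead _ _).le

end Symmetrization

/-! ### Adding a particle orthogonal to the given ones -/

section Excitation

/-- The condition on the adjoint says that L maps the orthogonal complement of U into that of V, so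
L respects both orthogonal decompositions. -/
theorem starProjection_comp_of_mapsTo {E F : Type*} [NormedAddCommGroup E] [InnerProductSpace ℂ E]
    [CompleteSpace E] [NormedAddCommGroup F] [InnerProductSpace ℂ F] [CompleteSpace F]
    (U : Submodule ℂ E) (V : Submodule ℂ F) [U.HasOrthogonalProjection] [V.HasOrthogonalProjection]
    (L : E →L[ℂ] F) (hL : ∀ x ∈ U, L x ∈ V) (hL' : ∀ y ∈ V, ContinuousLinearMap.adjoint L y ∈ U)
    (x : E) : V.starProjection (L x) = L (U.starProjection x) := by
  refine Submodule.eq_starProjection_of_mem_orthogonal (hL _ (U.starProjection_apply_mem x)) ?_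
  rw [← map_sub, Submodule.mem_orthogonal]
  intro y hy
  rw [← ContinuousLinearMap.adjoint_inner_left]
  exact (Submodule.mem_orthogonal _ _).1 (Submodule.sub_starProjection_mem_orthogonal x) _
    (hL' y hy)

/-! ### Bounded operators raising the degree in a Hilbert sum. -/

section Raise

variable {G : ℕ → Type*} [∀ i, NormedAddCommGroup (G i)] [∀ i, InnerProductSpace ℂ (G i)]

/-- The sequence `(0, S₀ ψ₀, S₁ ψ₁, …)`. -/
def raiseFun (S : ∀ n, G n →L[ℂ] G (n + 1)) (ψ : ∀ n, G n) : ∀ n, G n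
  | 0 => 0
  | n + 1 => S n (ψ n)

theorem norm_raiseFun_sq_le {S : ∀ n, G n →L[ℂ] G (n + 1)} {K : ℝ} (hK : ∀ n, ‖S n‖ ≤ K)
    (ψ : ∀ n, G n) (n : ℕ) : ‖raiseFun S ψ (n + 1)‖ ^ 2 ≤ K ^ 2 * ‖ψ n‖ ^ 2 := by
  rw [← mul_pow]
  exact pow_le_pow_left₀ (norm_nonneg _)
    (((S n).le_opNorm _).trans (mul_le_mul_of_nonneg_right (hK n) (norm_nonneg _))) 2

theorem summable_raiseFun {S : ∀ n, G n →L[ℂ] G (n + 1)} {K : ℝ} (hK : ∀ n, ‖S n‖ ≤ K)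
    (ψ : lp G 2) : Summable fun n => ‖raiseFun S ψ n‖ ^ 2 := by
  have h := (lp.memℓp ψ).summable (by norm_num)
  simp only [ENNReal.toReal_ofNat, Real.rpow_ofNat] at h
  exact (summable_nat_add_iff 1).1 (Summable.of_nonneg_of_le (fun _ => by positivity)
    (norm_raiseFun_sq_le hK ψ) (h.mul_left (K ^ 2)))

/-- The operator `ψ ↦ (0, S₀ ψ₀, S₁ ψ₁, …)` on a Hilbert sum, for a bounded family of operators. -/
def raise (S : ∀ n, G n →L[ℂ] G (n + 1)) {K : ℝ} (hK : ∀ n, ‖S n‖ ≤ K) : lp G 2 →L[ℂ] lp G 2 :=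
  LinearMap.mkContinuous
    { toFun := fun ψ => ⟨raiseFun S ψ, memℓp_gen (by simpa using summable_raiseFun hK ψ)⟩
      map_add' := fun ψ χ => by
        ext i
        cases i with
        | zero => exact (add_zero (0 : G 0)).symm
        | succ n => exact map_add (S n) _ _
      map_smul' := fun c ψ => by
        ext i
        cases i with
        | zero => exact (smul_zero c).symm
        | succ n => exact map_smul (S n) _ _ }
    |K| (fun ψ => by
      have h2 : (0 : ℝ) < (2 : ℝ≥0∞).toReal := by norm_num
      have h := (lp.memℓp ψ).summable (by norm_num)
      have h3 := lp.norm_rpow_eq_tsum h2 ψ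
      refine lp.norm_le_of_tsum_le h2 (by positivity) ?_
      simp only [ENNReal.toReal_ofNat, Real.rpow_ofNat] at h h3 ⊢
      rw [mul_pow, sq_abs, h3, ← tsum_mul_left]
      change ∑' n, ‖raiseFun S ψ n‖ ^ 2 ≤ _
      have hs := summable_raiseFun hK ψ
      rw [hs.tsum_eq_zero_add]
      change ‖(0 : G 0)‖ ^ 2 + _ ≤ _
      rw [norm_zero, zero_pow two_ne_zero, zero_add]
      exact ((summable_nat_add_iff 1).2 hs).tsum_le_tsum (norm_raiseFun_sq_le hK ψ)
        (h.mul_left _))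

end Raise

variable {s n : ℕ}

/-- The vectors without particles in the state `h`. -/
def vacuumSector (h : OneParticle s) : (n : ℕ) → Submodule ℂ (Symm s n)
  | 0 => ⊤
  | n + 1 => LinearMap.ker (annihilate h n : Symm s (n + 1) →ₗ[ℂ] Symm s n)

theorem mem_vacuumSector_succ {h : OneParticle s} {Φ : Symm s (n + 1)} :
    Φ ∈ vacuumSector h (n + 1) ↔ annihilate h n Φ = 0 := Iff.rfl

instance (h : OneParticle s) (n : ℕ) : (vacuumSector h n).HasOrthogonalProjection := by
  have hc : IsClosed (vacuumSector h n : Set (Symm s n)) := by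
    cases n with
    | zero => exact isClosed_univ
    | succ n => exact ContinuousLinearMap.isClosed_ker (annihilate h n)
  have : CompleteSpace (vacuumSector h n) := hc.completeSpace_coe
  infer_instance

theorem create_mem_vacuumSector {h f : OneParticle s} (hf : ⟪h, f⟫_ℂ = 0) {Φ : Symm s n}
    (hΦ : Φ ∈ vacuumSector h n) : create f n Φ ∈ vacuumSector h (n + 1) := by
  rw [mem_vacuumSector_succ]
  cases n with
  | zero => rw [annihilate_create_zero, hf, zero_smul]
  | succ n =>
    rw [annihilate_create, hf, zero_smul, zero_add, mem_vacuumSector_succ.1 hΦ, map_zero]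

theorem annihilate_mem_vacuumSector {h : OneParticle s} (f : OneParticle s) {Φ : Symm s (n + 1)}
    (hΦ : Φ ∈ vacuumSector h (n + 1)) : annihilate f n Φ ∈ vacuumSector h n := by
  cases n with
  | zero => trivial
  | succ n => rw [mem_vacuumSector_succ, annihilate_comm, mem_vacuumSector_succ.1 hΦ, map_zero]

/-- The projection onto the vectors without particles in the state `h`. -/
abbrev vacuumProj (h : OneParticle s) (n : ℕ) : Symm s n →L[ℂ] Symm s n :=
  (vacuumSector h n).starProjection

theorem vacuumProj_create {h f : OneParticle s} (hf : ⟪h, f⟫_ℂ = 0) (Φ : Symm s n) :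
    vacuumProj h (n + 1) (create f n Φ) = create f n (vacuumProj h n Φ) :=
  starProjection_comp_of_mapsTo _ _ _ (fun _ => create_mem_vacuumSector hf)
    (fun _ => annihilate_mem_vacuumSector f) _

theorem vacuumProj_annihilate {h f : OneParticle s} (hf : ⟪h, f⟫_ℂ = 0) (Φ : Symm s (n + 1)) :
    vacuumProj h n (annihilate f n Φ) = annihilate f n (vacuumProj h (n + 1) Φ) :=
  starProjection_comp_of_mapsTo _ _ _ (fun _ => annihilate_mem_vacuumSector f)
    (fun y hy => by
      rw [annihilate, ContinuousLinearMap.adjoint_adjoint]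
      exact create_mem_vacuumSector hf hy) _

/-- Commuting a(g) past a*(h) leaves the extra term ⟨Ψ, a*(h)a(g)Φ⟩, which vanishes because a(h)Ψ =
0. Only the left vector is restricted, and only with respect to h. -/
theorem inner_create_create {g h : OneParticle s} {Ψ : Symm s n} (hΨ : Ψ ∈ vacuumSector h n)
    (Φ : Symm s n) : ⟪create g n Ψ, create h n Φ⟫_ℂ = ⟪g, h⟫_ℂ * ⟪Ψ, Φ⟫_ℂ := by
  rw [inner_create_left]
  cases n with
  | zero => rw [annihilate_create_zero, inner_smul_right (𝕜 := ℂ) Ψ Φ]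
  | succ n =>
    rw [annihilate_create, inner_add_right (𝕜 := ℂ) Ψ, inner_smul_right (𝕜 := ℂ) Ψ Φ,
      ← inner_conj_symm Ψ (create h n _), inner_create_left, mem_vacuumSector_succ.1 hΨ,
      inner_zero_right, map_zero, add_zero]

theorem norm_create_of_mem {h : OneParticle s} {Φ : Symm s n} (hΦ : Φ ∈ vacuumSector h n) :
    ‖create h n Φ‖ = ‖h‖ * ‖Φ‖ := by
  have h1 := inner_create_create (g := h) hΦ Φ
  rw [inner_self_eq_norm_sq_to_K (𝕜 := ℂ) (create h n Φ), inner_self_eq_norm_sq_to_K (𝕜 := ℂ) Φ,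
    inner_self_eq_norm_sq_to_K (𝕜 := ℂ) h, ← mul_pow] at h1
  have h' : ‖create h n Φ‖ ^ 2 = (‖h‖ * ‖Φ‖) ^ 2 := by exact_mod_cast h1
  exact (pow_left_inj₀ (norm_nonneg _) (by positivity) two_ne_zero).1 h'

/-- The projection removes the growth √(n+1) of the norm of a*(h); the bound, uniform in n, is what
makes `excite` a bounded operator on Fock space. -/
theorem norm_create_vacuumProj_le (h : OneParticle s) (n : ℕ) :
    ‖create h n ∘L vacuumProj h n‖ ≤ ‖h‖ := by
  refine ContinuousLinearMap.opNorm_le_bound _ (norm_nonneg _) fun Φ => ?_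
  rw [ContinuousLinearMap.comp_apply, norm_create_of_mem (Submodule.starProjection_apply_mem _ _)]
  exact mul_le_mul_of_nonneg_left (Submodule.norm_starProjection_apply_le _ _) (norm_nonneg _)

/-- The bounded operator which creates a particle in the state `h` in the vectors which are without
such particles. -/
def excite (h : OneParticle s) : Fock s →L[ℂ] Fock s :=
  raise (G := fun n => Symm s n) (fun n => create h n ∘L vacuumProj h n)
    (norm_create_vacuumProj_le h)

theorem component_zero_excite (h : OneParticle s) (ψ : Fock s) :
    component s 0 (excite h ψ) = 0 := rfl

theorem component_succ_excite (h : OneParticle s) (ψ : Fock s) (n : ℕ) :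
    component s (n + 1) (excite h ψ) = create h n (vacuumProj h n (component s n ψ)) := rfl

theorem component_incl_self (n : ℕ) (Φ : Symm s n) : component s n (incl s n Φ) = Φ :=
  lp.single_apply_self (E := fun n => Symm s n) 2 n Φ

theorem component_incl_ne {m n : ℕ} (hmn : m ≠ n) (Φ : Symm s n) :
    component s m (incl s n Φ) = 0 :=
  lp.single_apply_ne (E := fun n => Symm s n) 2 n Φ hmn

theorem fock_ext {ψ χ : Fock s} (h : ∀ n, component s n ψ = component s n χ) : ψ = χ :=
  lp.ext (funext h)

theorem excite_incl {h : OneParticle s} {Φ : Symm s n} (hΦ : Φ ∈ vacuumSector h n) :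
    excite h (incl s n Φ) = incl s (n + 1) (create h n Φ) := by
  refine fock_ext fun m => ?_
  cases m with
  | zero => rw [component_zero_excite, component_incl_ne (by omega)]
  | succ m =>
    rw [component_succ_excite]
    rcases eq_or_ne m n with rfl | hmn
    · rw [component_incl_self, component_incl_self, Submodule.starProjection_eq_self_iff.2 hΦ]
    · rw [component_incl_ne hmn, component_incl_ne (by omega), map_zero, map_zero]

theorem annihilate_create_of_inner_eq_zero {h f : OneParticle s} (hf : ⟪f, h⟫_ℂ = 0)
    (Φ : Symm s (n + 1)) :
    annihilate f (n + 1) (create h (n + 1) Φ) = create h n (annihilate f n Φ) := by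
  rw [annihilate_create, hf, zero_smul, zero_add]

/-- For f orthogonal to h, both a(f) and a*(f) commute with a*(h) and with the projection onto
vectors without h-particles. -/
theorem excite_mem_fieldGraph₀ {h f : OneParticle s} (hf : ⟪h, f⟫_ℂ = 0) {q : Fock s × Fock s}
    (hq : q ∈ fieldGraph₀ f) : (excite h q.1, excite h q.2) ∈ fieldGraph₀ f := by
  have hf' : ⟪f, h⟫_ℂ = 0 := inner_eq_zero_symm.1 hf
  obtain ⟨⟨N, hN⟩, h0, h1⟩ := hq
  refine ⟨⟨N + 1, fun n hn => ?_⟩, ?_, fun n => ?_⟩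
  · obtain ⟨m, rfl⟩ : ∃ m, n = m + 1 := ⟨n - 1, by omega⟩
    rw [component_succ_excite, hN m (by omega), map_zero, map_zero]
  · rw [component_zero_excite, component_succ_excite, annihilate_create_zero, hf', zero_smul]
  · dsimp only
    cases n with
    | zero =>
      rw [component_succ_excite, component_zero_excite, component_succ_excite, h0, map_zero,
        vacuumProj_annihilate hf]
      exact (annihilate_create_of_inner_eq_zero hf' _).symm.trans (zero_add _).symm
    | succ n =>
      rw [component_succ_excite, component_succ_excite, component_succ_excite, h1, map_add,
        map_add, vacuumProj_create hf, vacuumProj_annihilate hf, create_comm,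
        annihilate_create_of_inner_eq_zero hf']

theorem excite_mem_fieldGraph {h f : OneParticle s} (hf : ⟪h, f⟫_ℂ = 0) {q : Fock s × Fock s}
    (hq : q ∈ fieldGraph f) : (excite h q.1, excite h q.2) ∈ fieldGraph f :=
  map_mem_closure (f := fun q : Fock s × Fock s => (excite h q.1, excite h q.2))
    ((excite h).continuous.prodMap (excite h).continuous) hq fun _ => excite_mem_fieldGraph₀ hf

/-- The graph of φ(f) is invariant under `excite h`, so the image of Rχ solves the resolvent
equation for the image of χ; the solution is unique. -/
theorem IsResolvent.commute_excite {lam : ℝ} {h f : OneParticle s} {R : Fock s →L[ℂ] Fock s}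
    (hR : IsResolvent lam f R) (hf : ⟪h, f⟫_ℂ = 0) : R * excite h = excite h * R := by
  ext1 χ
  refine (hR (excite h χ) (excite h (R χ))).2 ?_
  have h1 := excite_mem_fieldGraph hf ((hR χ (R χ)).1 rfl)
  simpa only [map_sub, map_smul] using h1

/-- An element of the algebra generated by the resolvents commutes with the creation of a particle
whose state is orthogonal to finitely many test functions. -/
theorem exists_commute_excite {A : Fock s →L[ℂ] Fock s}
    (hA : A ∈ Algebra.adjoin ℂ {R | ∃ (lam : ℝ) (f : Test s), lam ≠ 0 ∧
      IsResolvent lam f.toL2 R}) :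
    ∃ F : Set (Test s), F.Finite ∧ ∀ h : OneParticle s, (∀ f ∈ F, ⟪h, f.toL2⟫_ℂ = 0) →
      A * excite h = excite h * A := by
  induction hA using Algebra.adjoin_induction with
  | mem R hR =>
    obtain ⟨lam, f, -, hR⟩ := hR
    exact ⟨{f}, Set.finite_singleton f, fun h hh => hR.commute_excite (hh f rfl)⟩
  | algebraMap r =>
    exact ⟨∅, Set.finite_empty, fun h _ => Algebra.commutes r (excite h)⟩
  | add A B _ _ ihA ihB =>
    obtain ⟨F, hF, hA⟩ := ihA
    obtain ⟨F', hF', hB⟩ := ihB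
    exact ⟨F ∪ F', hF.union hF', fun h hh => by
      rw [add_mul, mul_add, hA h fun f hf => hh f (Or.inl hf), hB h fun f hf => hh f (Or.inr hf)]⟩
  | mul A B _ _ ihA ihB =>
    obtain ⟨F, hF, hA⟩ := ihA
    obtain ⟨F', hF', hB⟩ := ihB
    exact ⟨F ∪ F', hF.union hF', fun h hh => by
      rw [mul_assoc, hB h fun f hf => hh f (Or.inr hf), ← mul_assoc,
        hA h fun f hf => hh f (Or.inl hf), mul_assoc]⟩

end Excitation

/-! ### Translations to infinity -/

section Translations

/-- Uniformly bounded linear maps that converge on a set converge on its closed span. It is applied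
to state vectors and also, with E the space of bounded operators, to the norm closure of the
algebra. -/
theorem tendsto_of_mem_closure_span {X E F : Type*} [NormedAddCommGroup E] [NormedSpace ℂ E]
    [NormedAddCommGroup F] [NormedSpace ℂ F] {l : Filter X} {L : X → E →L[ℂ] F} {L₀ : E →L[ℂ] F}
    {C : ℝ} (hL : ∀ x v, ‖L x v‖ ≤ C * ‖v‖) {S : Set E}
    (hS : ∀ w ∈ S, Tendsto (fun x => L x w) l (𝓝 (L₀ w))) {v : E}
    (hv : v ∈ (Submodule.span ℂ S).topologicalClosure) :
    Tendsto (fun x => L x v) l (𝓝 (L₀ v)) := by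
  have hspan : ∀ w ∈ Submodule.span ℂ S, Tendsto (fun x => L x w) l (𝓝 (L₀ w)) := by
    intro w hw
    induction hw using Submodule.span_induction with
    | mem w hw => exact hS w hw
    | zero => simpa using tendsto_const_nhds
    | add a b _ _ ha hb => simpa using ha.add hb
    | smul c a _ ha => simpa using ha.const_smul c
  rw [Metric.tendsto_nhds]
  intro ε hε
  let K := |C| + ‖L₀‖ + 1
  have hK : 0 < K := by positivity
  obtain ⟨w, hw, hvw⟩ := Metric.mem_closure_iff.1 hv (ε / (2 * K)) (by positivity)
  filter_upwards [Metric.tendsto_nhds.1 (hspan w hw) (ε / 2) (by positivity)] with x hx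
  have h1 : ‖L x (v - w)‖ ≤ |C| * ‖v - w‖ :=
    (hL x _).trans (mul_le_mul_of_nonneg_right (le_abs_self C) (norm_nonneg _))
  have h2 : ‖L₀ (v - w)‖ ≤ ‖L₀‖ * ‖v - w‖ := L₀.le_opNorm _
  rw [dist_eq_norm] at hvw hx ⊢
  have h3 : L x v - L₀ v = L x (v - w) - L₀ (v - w) + (L x w - L₀ w) := by
    rw [map_sub, map_sub]
    abel
  have h4 : (|C| + ‖L₀‖) * ‖v - w‖ ≤ ε / 2 := by
    calc (|C| + ‖L₀‖) * ‖v - w‖ ≤ K * (ε / (2 * K)) :=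
          mul_le_mul (by simp [K]) hvw.le (norm_nonneg _) hK.le
      _ = ε / 2 := by field_simp
  rw [h3]
  calc _ ≤ ‖L x (v - w)‖ + ‖L₀ (v - w)‖ + ‖L x w - L₀ w‖ :=
        (norm_add_le _ _).trans (add_le_add_left (norm_sub_le _ _) _)
    _ < ε := by linarith

variable {s n : ℕ}

theorem coeFn_translate (x : Space s) (f : OneParticle s) :
    translate x f =ᵐ[volume] fun y => f (y + x) :=
  Lp.coeFn_compMeasurePreserving f (measurePreserving_add_right volume x)

theorem norm_translate (x : Space s) (f : OneParticle s) : ‖translate x f‖ = ‖f‖ :=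
  Lp.norm_compMeasurePreserving f (measurePreserving_add_right volume x)

theorem inner_translate_translate (x : Space s) (f g : OneParticle s) :
    ⟪translate x f, translate x g⟫_ℂ = ⟪f, g⟫_ℂ :=
  (Lp.compMeasurePreservingₗᵢ ℂ (fun y : Space s => y + x)
    (measurePreserving_add_right volume x)).inner_map_map f g

/-- The supports meet only if x lies in the compact set supp f - supp g. -/
theorem eventually_inner_translate (f g : Test s) :
    ∀ᶠ x in cocompact (Space s), ⟪translate x f.toL2, g.toL2⟫_ℂ = 0 := by
  have hK : IsCompact ((fun q : Space s × Space s => q.1 - q.2) '' (tsupport f ×ˢ tsupport g)) :=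
    (f.hasCompactSupport.isCompact.prod g.hasCompactSupport.isCompact).image (by fun_prop)
  filter_upwards [hK.compl_mem_cocompact] with x hx
  rw [MeasureTheory.L2.inner_def]
  refine integral_eq_zero_of_ae ?_
  have hmp := measurePreserving_add_right (volume : Measure (Space s)) x
  filter_upwards [coeFn_translate x f.toL2, g.coeFn_toL2,
    hmp.quasiMeasurePreserving.ae_eq_comp f.coeFn_toL2] with y h1 h2 h3
  rw [h1, h2]
  simp only [Function.comp_apply] at h3
  rw [h3]
  by_cases hf : f (y + x) = 0
  · simp [hf]
  · by_cases hg : g y = 0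
    · simp [hg]
    · exact absurd ⟨(y + x, y), ⟨subset_tsupport _ hf, subset_tsupport _ hg⟩,
        add_sub_cancel_left y x⟩ hx

theorem tendsto_inner_translate (f : Test s) (g : OneParticle s) :
    Tendsto (fun x => ⟪translate x f.toL2, g⟫_ℂ) (cocompact (Space s)) (𝓝 0) := by
  have h := tendsto_of_mem_closure_span (l := cocompact (Space s))
    (L := fun x => innerSL ℂ (translate x f.toL2)) (L₀ := 0) (C := ‖f.toL2‖)
    (S := Set.range Test.toL2) (v := g) (fun x v => ?_) ?_ ?_
  · simpa using h
  · rw [innerSL_apply_apply, ← norm_translate x f.toL2]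
    exact norm_inner_le_norm _ _
  · rintro _ ⟨g, rfl⟩
    refine tendsto_const_nhds.congr' ?_
    filter_upwards [eventually_inner_translate f g] with x hx
    rw [innerSL_apply_apply, hx]
    rfl
  · exact closure_mono Submodule.subset_span (denseRange_toL2 s g)

/-- The symmetric product of test functions. -/
abbrev testVec (u : Fin n → Test s) : Symm s n := symmVec fun i => (u i).toL2

theorem span_range_testVec (s n : ℕ) :
    (Submodule.span ℂ (Set.range (testVec (s := s) (n := n)))).topologicalClosure = ⊤ := by
  refine eq_top_iff.2 fun Φ _ => ?_
  have h1 : (Φ : Unsymm s n) ∈ (Submodule.span ℂ (Set.range fun f : Fin n → Test s =>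
      prodVec fun i => (f i).toL2)).topologicalClosure := by
    rw [span_range_prodVec_toL2]
    trivial
  rw [← symmetrize_coe Φ]
  refine map_mem_closure (symmetrize s n).continuous h1 fun ψ hψ => ?_
  have h2 := Submodule.mem_map_of_mem (f := (symmetrize s n : Unsymm s n →ₗ[ℂ] Symm s n)) hψ
  rw [Submodule.map_span, ← Set.range_comp] at h2
  exact h2

theorem symmVec_mem_vacuumSector {h : OneParticle s} {u : Fin n → OneParticle s}
    (hu : ∀ i, ⟪h, u i⟫_ℂ = 0) : symmVec u ∈ vacuumSector h n := by
  cases n with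
  | zero => trivial
  | succ n =>
    rw [mem_vacuumSector_succ]
    apply Subtype.ext
    rw [coe_annihilate, symmVec, coe_symmetrize]
    simp only [map_smul, map_sum, permL_prodVec, contract_prodVec, Function.comp_apply, hu,
      zero_smul, Finset.sum_const_zero, smul_zero]
    rfl

/-- The creation operator puts f in front, the product has it at the end; the cyclic rotation
relating them is absorbed by symmetrization. -/
theorem symmVec_snoc (u : Fin n → OneParticle s) (f : OneParticle s) :
    ((Real.sqrt (n + 1) : ℝ) : ℂ) • symmVec (Fin.snoc u f : Fin (n + 1) → OneParticle s) =
      create f n (symmVec u) := by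
  rw [coe_create, symmVec, symmVec, symmetrize_tensorHead_symmetrize, tensorHead_prodVec,
    ← symmetrize_permL (finRotate (n + 1)) (prodVec (Fin.cons f u : Fin (n + 1) → OneParticle s)),
    permL_prodVec, Fin.snoc_eq_cons_rotate]
  rfl

theorem inner_incl_left (Ψ : Symm s n) (χ : Fock s) :
    ⟪incl s n Ψ, χ⟫_ℂ = ⟪Ψ, component s n χ⟫_ℂ :=
  lp.inner_single_left (G := fun n => Symm s n) n Ψ χ

theorem norm_incl (Ψ : Symm s n) : ‖incl s n Ψ‖ = ‖Ψ‖ :=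
  lp.norm_single (E := fun n => Symm s n) (by norm_num) n Ψ

theorem norm_incl_create_translate_le (x : Space s) (f : OneParticle s) (Φ : Symm s n) :
    ‖incl s (n + 1) (create (translate x f) n Φ)‖ ≤ Real.sqrt (n + 1) * ‖f‖ * ‖Φ‖ := by
  rw [norm_incl, ← norm_translate x f]
  exact ContinuousLinearMap.le_of_opNorm_le _ (norm_create_le _ _) _

/-- The core of the argument: for A in the algebra before closure the factorization is an equality
for large x. Only f(x) has to be orthogonal to the other functions; g(x) enters through ⟨g(x),f(x)⟩
= ⟨g,f⟩. -/
theorem eventually_inner_create_testVec {A : Fock s →L[ℂ] Fock s}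
    (hA : A ∈ Algebra.adjoin ℂ {R | ∃ (lam : ℝ) (f : Test s), lam ≠ 0 ∧
      IsResolvent lam f.toL2 R}) (f g : Test s) (u v : Fin n → Test s) :
    ∀ᶠ x in cocompact (Space s),
      ⟪incl s (n + 1) (create (translate x g.toL2) n (testVec v)),
        A (incl s (n + 1) (create (translate x f.toL2) n (testVec u)))⟫_ℂ =
      ⟪g.toL2, f.toL2⟫_ℂ * ⟪incl s n (testVec v), A (incl s n (testVec u))⟫_ℂ := by
  obtain ⟨F, hF, hcomm⟩ := exists_commute_excite hA
  filter_upwards [(Filter.eventually_all_finite hF).2 fun k _ => eventually_inner_translate f k,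
    Filter.eventually_all.2 fun i => eventually_inner_translate f (u i),
    Filter.eventually_all.2 fun i => eventually_inner_translate f (v i)] with x h1 h2 h3
  have hu := symmVec_mem_vacuumSector h2
  have hv := symmVec_mem_vacuumSector h3
  have h4 : A (incl s (n + 1) (create (translate x f.toL2) n (testVec u))) =
      excite (translate x f.toL2) (A (incl s n (testVec u))) := by
    rw [← excite_incl hu]
    exact congrArg (fun T => T (incl s n (testVec u))) (hcomm _ h1)
  -- The projection in `excite` stands before A Φ, which may contain f(x); it is moved to the left
  -- vector, which it fixes.
  rw [h4, inner_incl_left, component_succ_excite, inner_create_create hv,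
    inner_translate_translate, inner_incl_left, ← Submodule.inner_starProjection_left_eq_right,
    Submodule.starProjection_eq_self_iff.2 hv]

theorem tendsto_inner_create_testVec {A : Fock s →L[ℂ] Fock s} (hA : A ∈ resolventAlgebra s)
    (f g : Test s) (u v : Fin n → Test s) :
    Tendsto (fun x => ⟪incl s (n + 1) (create (translate x g.toL2) n (testVec v)),
        A (incl s (n + 1) (create (translate x f.toL2) n (testVec u)))⟫_ℂ) (cocompact (Space s))
      (𝓝 (⟪g.toL2, f.toL2⟫_ℂ * ⟪incl s n (testVec v), A (incl s n (testVec u))⟫_ℂ)) := by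
  have h := tendsto_of_mem_closure_span (l := cocompact (Space s))
    (L := fun x => innerSL ℂ (incl s (n + 1) (create (translate x g.toL2) n (testVec v))) ∘L
      ContinuousLinearMap.apply ℂ (Fock s)
        (incl s (n + 1) (create (translate x f.toL2) n (testVec u))))
    (L₀ := ⟪g.toL2, f.toL2⟫_ℂ • (innerSL ℂ (incl s n (testVec v)) ∘L
      ContinuousLinearMap.apply ℂ (Fock s) (incl s n (testVec u))))
    (C := (Real.sqrt (n + 1) * ‖g.toL2‖ * ‖testVec v‖) *
      (Real.sqrt (n + 1) * ‖f.toL2‖ * ‖testVec u‖))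
    (S := Algebra.adjoin ℂ {R | ∃ (lam : ℝ) (f : Test s), lam ≠ 0 ∧
      IsResolvent lam f.toL2 R}) (v := A) (fun x B => ?_) (fun B hB => ?_) ?_
  · exact h
  · refine (norm_inner_le_norm (𝕜 := ℂ) (E := Fock s) _ _).trans ?_
    rw [mul_assoc]
    refine mul_le_mul (norm_incl_create_translate_le _ _ _) ?_ (norm_nonneg _) (by positivity)
    rw [mul_comm]
    exact (B.le_opNorm _).trans (mul_le_mul_of_nonneg_left (norm_incl_create_translate_le _ _ _)
      (norm_nonneg _))
  · exact tendsto_const_nhds.congr'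
      ((eventually_inner_create_testVec hB f g u v).mono fun x hx => hx.symm)
  · exact closure_mono Submodule.subset_span hA

theorem tendsto_inner_create {A : Fock s →L[ℂ] Fock s} (hA : A ∈ resolventAlgebra s)
    (f g : Test s) (Ψ Φ : Symm s n) :
    Tendsto (fun x => ⟪incl s (n + 1) (create (translate x g.toL2) n Ψ),
        A (incl s (n + 1) (create (translate x f.toL2) n Φ))⟫_ℂ) (cocompact (Space s))
      (𝓝 (⟪g.toL2, f.toL2⟫_ℂ * ⟪incl s n Ψ, A (incl s n Φ)⟫_ℂ)) := by
  have hmem : ∀ Φ : Symm s n,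
      Φ ∈ (Submodule.span ℂ (Set.range (testVec (s := s) (n := n)))).topologicalClosure := by
    intro Φ
    rw [span_range_testVec]
    trivial
  have h1 : ∀ v : Fin n → Test s,
      Tendsto (fun x => ⟪incl s (n + 1) (create (translate x g.toL2) n (testVec v)),
        A (incl s (n + 1) (create (translate x f.toL2) n Φ))⟫_ℂ) (cocompact (Space s))
      (𝓝 (⟪g.toL2, f.toL2⟫_ℂ * ⟪incl s n (testVec v), A (incl s n Φ)⟫_ℂ)) := by
    intro v
    refine tendsto_of_mem_closure_span (l := cocompact (Space s))
      (L := fun x => innerSL ℂ (incl s (n + 1) (create (translate x g.toL2) n (testVec v))) ∘L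
        A ∘L incl s (n + 1) ∘L create (translate x f.toL2) n)
      (L₀ := ⟪g.toL2, f.toL2⟫_ℂ • (innerSL ℂ (incl s n (testVec v)) ∘L A ∘L incl s n))
      (C := (Real.sqrt (n + 1) * ‖g.toL2‖ * ‖testVec v‖) *
        (‖A‖ * (Real.sqrt (n + 1) * ‖f.toL2‖)))
      (S := Set.range testVec) (v := Φ) (fun x χ => ?_) ?_ (hmem Φ)
    · refine (norm_inner_le_norm (𝕜 := ℂ) (E := Fock s) _ _).trans ?_
      rw [mul_assoc]
      refine mul_le_mul (norm_incl_create_translate_le _ _ _) ?_ (norm_nonneg _) (by positivity)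
      rw [mul_assoc]
      exact (A.le_opNorm _).trans (mul_le_mul_of_nonneg_left
        (norm_incl_create_translate_le _ _ _) (norm_nonneg _))
    · rintro _ ⟨u, rfl⟩
      exact tendsto_inner_create_testVec hA f g u v
  -- The inner product is antilinear in Ψ; the conjugated expression is linear, as the density
  -- argument requires.
  have h2 : Tendsto (fun x => ⟪A (incl s (n + 1) (create (translate x f.toL2) n Φ)),
        incl s (n + 1) (create (translate x g.toL2) n Ψ)⟫_ℂ) (cocompact (Space s))
      (𝓝 (⟪f.toL2, g.toL2⟫_ℂ * ⟪A (incl s n Φ), incl s n Ψ⟫_ℂ)) := by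
    refine tendsto_of_mem_closure_span (l := cocompact (Space s))
      (L := fun x => innerSL ℂ (A (incl s (n + 1) (create (translate x f.toL2) n Φ))) ∘L
        incl s (n + 1) ∘L create (translate x g.toL2) n)
      (L₀ := ⟪f.toL2, g.toL2⟫_ℂ • (innerSL ℂ (A (incl s n Φ)) ∘L incl s n))
      (C := (‖A‖ * (Real.sqrt (n + 1) * ‖f.toL2‖ * ‖Φ‖)) *
        (Real.sqrt (n + 1) * ‖g.toL2‖))
      (S := Set.range testVec) (v := Ψ) (fun x χ => ?_) ?_ (hmem Ψ)
    · refine (norm_inner_le_norm (𝕜 := ℂ) (E := Fock s) _ _).trans ?_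
      rw [mul_assoc]
      exact mul_le_mul ((A.le_opNorm _).trans (mul_le_mul_of_nonneg_left
        (norm_incl_create_translate_le _ _ _) (norm_nonneg _)))
        (norm_incl_create_translate_le _ _ _) (norm_nonneg _) (by positivity)
    · rintro _ ⟨v, rfl⟩
      have h3 := (Complex.continuous_conj.tendsto _).comp (h1 v)
      rw [map_mul, inner_conj_symm, inner_conj_symm] at h3
      refine h3.congr fun x => ?_
      rw [Function.comp_apply, inner_conj_symm]
      rfl
  have h3 := (Complex.continuous_conj.tendsto _).comp h2
  rw [map_mul, inner_conj_symm, inner_conj_symm] at h3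
  refine h3.congr fun x => ?_
  rw [Function.comp_apply, inner_conj_symm]

theorem sqrt_smul_farVec {k : ℕ} (f : Fin (k + 1) → Test s) (x : Space s) :
    ((Real.sqrt (k + 1) : ℝ) : ℂ) • farVec f x = incl s (k + 1)
      (create (translate x (f (Fin.last k)).toL2) k (testVec fun i => f i.castSucc)) := by
  rw [farVec, ← map_smul, symmVec_snoc]

theorem tendsto_inner_farVec {A : Fock s →L[ℂ] Fock s} (hA : A ∈ resolventAlgebra s) {k : ℕ}
    (f g : Fin (k + 1) → Test s) :
    Tendsto (fun x : Space s => ⟪farVec g x, A (farVec f x)⟫_ℂ) (cocompact (Space s))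
      (𝓝 (((k + 1 : ℕ) : ℂ)⁻¹ * ⟪nearVec g, A (nearVec f)⟫_ℂ *
        ⟪(g (Fin.last k)).toL2, (f (Fin.last k)).toL2⟫_ℂ)) := by
  have h := (tendsto_inner_create hA (f (Fin.last k)) (g (Fin.last k))
    (testVec fun i => g i.castSucc) (testVec fun i => f i.castSucc)).const_mul
      (((k + 1 : ℕ) : ℂ)⁻¹)
  rw [mul_comm ⟪(g (Fin.last k)).toL2, _⟫_ℂ, ← mul_assoc] at h
  refine h.congr fun x => ?_
  rw [← sqrt_smul_farVec, ← sqrt_smul_farVec, map_smul, inner_smul_left, inner_smul_right,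
    Complex.conj_ofReal, ← mul_assoc (Complex.ofReal _), sqrt_mul_self_cast,
    inv_mul_cancel_left₀ (by exact_mod_cast k.succ_ne_zero)]

end Translations

/-! ### Gauge invariance and monotonicity of the norms -/

section Gauge

variable {s : ℕ}

theorem component_gauge (t : ℝ) (ψ : Fock s) (n : ℕ) :
    component s n (gauge s t ψ) = Complex.exp (Complex.I * t * n) • component s n ψ := rfl

theorem gauge_incl (t : ℝ) (n : ℕ) (Φ : Symm s n) :
    gauge s t (incl s n Φ) = Complex.exp (Complex.I * t * n) • incl s n Φ := by
  refine fock_ext fun m => ?_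
  rw [component_gauge, map_smul]
  rcases eq_or_ne m n with rfl | h
  · rfl
  · rw [component_incl_ne h, smul_zero, smul_zero]

theorem component_apply_incl_of_ne {A : Fock s →L[ℂ] Fock s}
    (hA : A ∈ Subalgebra.centralizer ℂ (Set.range (gauge s))) {m n : ℕ} (hmn : m ≠ n)
    (Φ : Symm s n) : component s m (A (incl s n Φ)) = 0 := by
  have hne : ((m : ℝ) - n) ≠ 0 := sub_ne_zero.2 (by exact_mod_cast hmn)
  -- With this t the phases on 𝓕ₘ and 𝓕ₙ are opposite, so the component equals its own negative.
  let t : ℝ := Real.pi / (m - n)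
  have h1 : gauge s t (A (incl s n Φ)) = A (gauge s t (incl s n Φ)) :=
    congrArg (fun T => T (incl s n Φ))
      ((Subalgebra.mem_centralizer_iff ℂ).1 hA (gauge s t) ⟨t, rfl⟩)
  have h2 := congrArg (component s m) h1
  rw [gauge_incl, map_smul, map_smul, component_gauge] at h2
  have h3 : Complex.exp (Complex.I * t * m) = -Complex.exp (Complex.I * t * n) := by
    have h4 : t * m = Real.pi + t * n := by
      simp only [t]
      field_simp
      ring
    rw [show Complex.I * t * m = Real.pi * Complex.I + Complex.I * t * n by
      rw [mul_assoc, ← Complex.ofReal_natCast m, ← Complex.ofReal_mul, h4]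
      push_cast
      ring, Complex.exp_add, Complex.exp_pi_mul_I, neg_one_mul]
  rw [h3, neg_smul, neg_eq_iff_add_eq_zero, ← two_smul ℂ, smul_smul] at h2
  exact (smul_eq_zero.1 h2).resolve_left (mul_ne_zero two_ne_zero (Complex.exp_ne_zero _))

theorem apply_incl_eq_incl_component {A : Fock s →L[ℂ] Fock s}
    (hA : A ∈ Subalgebra.centralizer ℂ (Set.range (gauge s))) {n : ℕ} (Φ : Symm s n) :
    A (incl s n Φ) = incl s n (component s n (A (incl s n Φ))) := by
  refine fock_ext fun m => ?_
  rcases eq_or_ne m n with rfl | h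
  · rw [component_incl_self]
  · rw [component_apply_incl_of_ne hA h, component_incl_ne h]

/-- For s = 0 the space is a point and limits at infinity carry no information; this is where s ≥ 1
enters. -/
theorem neBot_cocompact_space (hs : 1 ≤ s) : (cocompact (Space s)).NeBot := by
  have : Nonempty (Fin s) := ⟨⟨0, hs⟩⟩
  have : NoncompactSpace (Space s) := NormedSpace.noncompactSpace ℝ _
  infer_instance

theorem tendsto_norm_create_translate (f : Test s) {n : ℕ} (Ψ : Symm s n) :
    Tendsto (fun x => ‖incl s (n + 1) (create (translate x f.toL2) n Ψ)‖) (cocompact (Space s))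
      (𝓝 (‖f.toL2‖ * ‖Ψ‖)) := by
  have h := (tendsto_inner_create (one_mem (resolventAlgebra s)) f f Ψ Ψ).norm.sqrt
  have h2 : ∀ {E : Type} [NormedAddCommGroup E] [InnerProductSpace ℂ E] (v : E),
      ‖⟪v, v⟫_ℂ‖ = ‖v‖ ^ 2 := fun v => by
    rw [inner_self_eq_norm_sq_to_K (𝕜 := ℂ) v]
    simp
  simp only [one_apply_eq_self, norm_mul, h2, norm_incl (n := n), ← mul_pow] at h
  rw [Real.sqrt_sq (by positivity)] at h
  refine h.congr fun x => Real.sqrt_sq (norm_nonneg _)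

/-- With Ψ = AΦ the limit formula and the Cauchy-Schwarz inequality give ‖f‖²‖Ψ‖² ≤ ‖f‖²‖Ψ‖ ‖A‖ₖ₊₁
‖Φ‖. -/
theorem norm_restrict_le_succ (hs : 1 ≤ s) {A : Fock s →L[ℂ] Fock s}
    (hA : A ∈ gaugeInvariantAlgebra s) (k : ℕ) : ‖restrict A k‖ ≤ ‖restrict A (k + 1)‖ := by
  have := neBot_cocompact_space hs
  obtain ⟨f, hf⟩ := exists_toL2_ne_zero s
  refine ContinuousLinearMap.opNorm_le_bound _ (ContinuousLinearMap.opNorm_nonneg _) fun Φ => ?_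
  change ‖A (incl s k Φ)‖ ≤ _
  obtain ⟨Ψ, hΨ⟩ : ∃ Ψ, A (incl s k Φ) = incl s k Ψ := ⟨_, apply_incl_eq_incl_component hA.2 Φ⟩
  have h1 := (tendsto_inner_create hA.1 f f Ψ Φ).norm
  have h2 := ((tendsto_norm_create_translate f Ψ).mul
    ((tendsto_norm_create_translate f Φ).const_mul ‖restrict A (k + 1)‖))
  have h3 := le_of_tendsto_of_tendsto' h1 h2 fun x => by
    refine (norm_inner_le_norm (𝕜 := ℂ) (E := Fock s) _ _).trans
      (mul_le_mul_of_nonneg_left ?_ (norm_nonneg _))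
    rw [norm_incl (create _ _ _)]
    exact (restrict A (k + 1)).le_opNorm _
  rw [hΨ, inner_self_eq_norm_sq_to_K (𝕜 := ℂ) (incl s k Ψ),
    inner_self_eq_norm_sq_to_K (𝕜 := ℂ) f.toL2, norm_incl Ψ] at h3
  rw [hΨ, norm_incl]
  have hf' : 0 < ‖f.toL2‖ ^ 2 := by positivity
  rcases (norm_nonneg Ψ).eq_or_lt with h | h
  · rw [← h]
    positivity
  · refine le_of_mul_le_mul_left ?_ (mul_pos hf' h)
    simp only [norm_mul, norm_pow, Complex.coe_algebraMap, Complex.norm_real, norm_norm] at h3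
    linarith

end Gauge

/-! ### Symmetrized tensor products with the identity -/

section Amplification

/-- Images under T stay in a compact set, and every cluster point is orthogonal to all w, since
⟨Ty,w⟩ = ⟨y,T*w⟩ tends to 0. -/
theorem tendsto_zero_of_isCompactOperator {X E F : Type*} [NormedAddCommGroup E]
    [InnerProductSpace ℂ E] [CompleteSpace E] [NormedAddCommGroup F] [InnerProductSpace ℂ F]
    [CompleteSpace F] {T : E →L[ℂ] F} (hT : IsCompactOperator T) {l : Filter X} {y : X → E} {r : ℝ}
    (hr : ∀ x, ‖y x‖ ≤ r) (hy : ∀ w, Tendsto (fun x => ⟪y x, w⟫_ℂ) l (𝓝 0)) :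
    Tendsto (fun x => T (y x)) l (𝓝 0) := by
  obtain ⟨K, hK, hTK⟩ :=
    IsCompactOperator.image_closedBall_subset_compact (f := (T : E →ₗ[ℂ] F)) hT r
  refine hK.tendsto_nhds_of_unique_mapClusterPt
    (Eventually.of_forall fun x => hTK ⟨y x, mem_closedBall_zero_iff.2 (hr x), rfl⟩)
    fun z _ hz => ?_
  refine ext_inner_right ℂ fun w => ?_
  have h1 : Tendsto (fun x => ⟪T (y x), w⟫_ℂ) l (𝓝 0) := by
    refine (hy (ContinuousLinearMap.adjoint T w)).congr fun x => ?_
    rw [ContinuousLinearMap.adjoint_inner_right]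
  have h2 : MapClusterPt ⟪z, w⟫_ℂ l fun x => ⟪T (y x), w⟫_ℂ :=
    hz.continuousAt_comp (f := fun v => ⟪v, w⟫_ℂ) (by fun_prop)
  rw [inner_zero_left]
  exact eq_of_nhds_neBot (ClusterPt.mono h2 h1)

variable {s m n : ℕ}

theorem norm_prodVec_update_translate (c : Fin m → OneParticle s) (p : Fin m) (f : OneParticle s)
    (x : Space s) : ‖prodVec (Function.update c p (translate x f))‖ =
      ‖prodVec (Function.update c p f)‖ := by
  rw [norm_prodVec, norm_prodVec]
  refine Finset.prod_congr rfl fun j _ => ?_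
  rcases eq_or_ne j p with rfl | h
  · rw [Function.update_self, Function.update_self, norm_translate]
  · rw [Function.update_of_ne h, Function.update_of_ne h]

theorem tendsto_inner_prodVec_update (c : Fin m → OneParticle s) (p : Fin m) (f : Test s)
    (w : Unsymm s m) :
    Tendsto (fun x => ⟪prodVec (Function.update c p (translate x f.toL2)), w⟫_ℂ)
      (cocompact (Space s)) (𝓝 0) := by
  refine tendsto_of_mem_closure_span
    (L := fun x => innerSL ℂ (prodVec (Function.update c p (translate x f.toL2)))) (L₀ := 0)
    (C := ‖prodVec (Function.update c p f.toL2)‖) (S := Set.range prodVec) (fun x v => ?_) ?_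
    (by rw [span_range_prodVec]; trivial)
  · rw [← norm_prodVec_update_translate c p _ x]
    exact norm_inner_le_norm (𝕜 := ℂ) (E := Unsymm s m) _ _
  · rintro _ ⟨g, rfl⟩
    have h := (tendsto_inner_translate f (g p)).mul_const
      (∏ j ∈ Finset.univ.erase p, ⟪c j, g j⟫_ℂ)
    rw [zero_mul] at h
    refine h.congr fun x => ?_
    rw [innerSL_apply_apply, inner_prodVec, ← Finset.mul_prod_erase _ _ (Finset.mem_univ p),
      Function.update_self]
    congr 1
    refine Finset.prod_congr rfl fun j hj => ?_
    rw [Function.update_of_ne (Finset.ne_of_mem_erase hj)]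

/-- The operator `C ⊗ 1` on the unsymmetrized space, where `C` is extended by zero to the
orthogonal complement of the symmetric subspace. -/
abbrev amplUnsymm (h : m ≤ n) (C : Symm s m →L[ℂ] Symm s m) : Unsymm s n →L[ℂ] Unsymm s n :=
  tensorOne (measurePreserving_split s h) (symmIncl s m ∘L C ∘L symmetrize s m)

theorem ampl_apply (h : m ≤ n) (C : Symm s m →L[ℂ] Symm s m) (Φ : Symm s n) :
    ampl h C Φ = symmetrize s n (amplUnsymm h C (Φ : Unsymm s n)) := rfl

theorem amplUnsymm_prodVec (h : m ≤ n) (C : Symm s m →L[ℂ] Symm s m)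
    (g : Fin n → OneParticle s) :
    amplUnsymm h C (prodVec g) = tensor (measurePreserving_split s h)
      (C (symmetrize s m (prodVec fun i => g (Fin.castLE h i))) : Unsymm s m)
      (prodVec fun j : Fin (n - m) => g ⟨m + j, by omega⟩) := by
  conv_lhs => rw [← tensor_split_prodVec h g]
  exact tensorOne_tensor _ _ _ _

/-- A cycle, unlike a transposition, moves f into slot p while keeping the order of the other
factors; for p ≥ m the first m factors stay in place. -/
theorem permL_cycleRange_tensorHead_prodVec (p : Fin (n + 1)) (f : OneParticle s)
    (φ : Fin n → OneParticle s) :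
    permL s (n + 1) p.cycleRange (tensorHead f (prodVec φ)) =
      prodVec (p.insertNth f φ : Fin (n + 1) → OneParticle s) := by
  rw [tensorHead_prodVec, permL_prodVec, Fin.cons_comp_cycleRange]

theorem insertNth_eq_update (p : Fin (n + 1)) (f : OneParticle s) (φ : Fin n → OneParticle s) :
    (p.insertNth f φ : Fin (n + 1) → OneParticle s) =
      Function.update (p.insertNth 0 φ : Fin (n + 1) → OneParticle s) p f := by
  rw [Fin.update_insertNth]

/-- A compact operator annihilates asymptotically the vectors which have a particle at infinity. -/
theorem tendsto_amplUnsymm_permL (h : m ≤ n + 1) {C : Symm s m →L[ℂ] Symm s m}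
    (hC : IsCompactOperator C) {p : Fin (n + 1)} (hp : (p : ℕ) < m) (f : Test s)
    (ψ : Unsymm s n) :
    Tendsto (fun x => amplUnsymm h C (permL s (n + 1) p.cycleRange
      (tensorHead (translate x f.toL2) ψ))) (cocompact (Space s)) (𝓝 0) := by
  refine tendsto_of_mem_closure_span
    (L := fun x => amplUnsymm h C ∘L (permL s (n + 1) p.cycleRange).toContinuousLinearMap ∘L
      tensorHead (translate x f.toL2)) (L₀ := 0) (C := ‖amplUnsymm h C‖ * ‖f.toL2‖)
    (S := Set.range prodVec) (fun x v => ?_) ?_ (by rw [span_range_prodVec]; trivial)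
  · refine ((amplUnsymm h C).le_opNorm _).trans ?_
    rw [mul_assoc, ← norm_translate x f.toL2, ← norm_tensorHead]
    exact mul_le_mul_of_nonneg_left ((permL s (n + 1) p.cycleRange).norm_map _).le (norm_nonneg _)
  · rintro _ ⟨φ, rfl⟩
    let c : Fin (n + 1) → OneParticle s := p.insertNth 0 φ
    let q : Fin m := ⟨p, hp⟩
    have hq : ∀ x, (fun i : Fin m => Function.update c p (translate x f.toL2) (Fin.castLE h i)) =
        Function.update (fun i : Fin m => c (Fin.castLE h i)) q (translate x f.toL2) := fun x =>
      Function.update_comp_eq_of_injective c (Fin.castLE_injective h) q _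
    have hrest : ∀ x, (fun j : Fin (n + 1 - m) =>
        Function.update c p (translate x f.toL2) ⟨m + j, by omega⟩) =
          fun j : Fin (n + 1 - m) => c ⟨m + j, by omega⟩ := fun x => by
      funext j
      rw [Function.update_of_ne]
      intro h'
      have := congrArg Fin.val h'
      simp only at this
      omega
    have h1 : Tendsto (fun x => C (symmetrize s m (prodVec
        (Function.update (fun i : Fin m => c (Fin.castLE h i)) q (translate x f.toL2)))))
        (cocompact (Space s)) (𝓝 0) := by
      refine tendsto_zero_of_isCompactOperator hC
        (r := ‖prodVec (Function.update (fun i : Fin m => c (Fin.castLE h i)) q f.toL2)‖)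
        (fun x => ?_) fun w => ?_
      · rw [← norm_prodVec_update_translate _ q _ x]
        exact norm_symmetrize_le _
      · have h2 := tendsto_inner_prodVec_update (fun i : Fin m => c (Fin.castLE h i)) q f
          (w : Unsymm s m)
        refine h2.congr fun x => ?_
        rw [← inner_conj_symm, ← inner_symmetrize]
        exact inner_conj_symm (𝕜 := ℂ) (E := Symm s m) _ _
    have h3 := ((tensorR (measurePreserving_split s h)
      (prodVec fun j : Fin (n + 1 - m) => c ⟨m + j, by omega⟩) ∘L symmIncl s m).continuous.tendsto
        0).comp h1
    rw [map_zero] at h3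
    refine h3.congr fun x => ?_
    change tensor (measurePreserving_split s h) _ _ = amplUnsymm h C (permL s (n + 1) p.cycleRange
      (tensorHead (translate x f.toL2) (prodVec φ)))
    rw [permL_cycleRange_tensorHead_prodVec, insertNth_eq_update, amplUnsymm_prodVec, hq, hrest]
    rfl

/-- A spectator in slot p ≥ m may be moved to the front under symmetrization. For product ξ this is
a cyclic permutation of factors; density covers the correlated vectors produced by C. -/
theorem symmetrize_tensor_insertNth (h : m ≤ n) (h' : m ≤ n + 1) {p : Fin (n + 1)}
    (hp : m ≤ (p : ℕ)) (f : OneParticle s) (ξ : Unsymm s m) (φ : Fin n → OneParticle s) :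
    symmetrize s (n + 1) (tensor (measurePreserving_split s h') ξ
      (prodVec fun j : Fin (n + 1 - m) =>
        (p.insertNth f φ : Fin (n + 1) → OneParticle s) ⟨m + j, by omega⟩)) =
    symmetrize s (n + 1) (tensorHead f (tensor (measurePreserving_split s h) ξ
      (prodVec fun j : Fin (n - m) => φ ⟨m + j, by omega⟩))) := by
  have H : symmetrize s (n + 1) ∘L tensorR (measurePreserving_split s h')
      (prodVec fun j : Fin (n + 1 - m) =>
        (p.insertNth f φ : Fin (n + 1) → OneParticle s) ⟨m + j, by omega⟩) =
      symmetrize s (n + 1) ∘L tensorHead f ∘L tensorR (measurePreserving_split s h)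
      (prodVec fun j : Fin (n - m) => φ ⟨m + j, by omega⟩) := by
    refine ext_prodVec fun η => ?_
    -- The factors η on the first m slots and φ on the rest are glued into a single product, so that
    -- `tensor_split_prodVec` applies.
    let χ : Fin n → OneParticle s := fun i => if hi : (i : ℕ) < m then η ⟨i, hi⟩ else φ i
    have hχ₁ : (fun i : Fin m => χ (Fin.castLE h i)) = η := by
      funext i
      simp [χ]
    have hχ₂ : (fun j : Fin (n - m) => χ ⟨m + j, by omega⟩) =
        fun j : Fin (n - m) => φ ⟨m + j, by omega⟩ := by
      funext j
      simp [χ]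
    have hχ₃ : (fun i : Fin m => (p.insertNth f χ : Fin (n + 1) → OneParticle s)
        (Fin.castLE h' i)) = η := by
      funext i
      rw [Fin.insertNth_apply_below (Fin.lt_def.2 (i.2.trans_le hp) :
        Fin.castLE h' i < p)]
      simp [χ]
    have hχ₄ : (fun j : Fin (n + 1 - m) =>
        (p.insertNth f χ : Fin (n + 1) → OneParticle s) ⟨m + j, by omega⟩) =
        fun j : Fin (n + 1 - m) =>
          (p.insertNth f φ : Fin (n + 1) → OneParticle s) ⟨m + j, by omega⟩ := by
      funext j
      rcases lt_trichotomy (⟨m + j, by omega⟩ : Fin (n + 1)) p with hj | hj | hj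
      · rw [Fin.insertNth_apply_below hj, Fin.insertNth_apply_below hj]
        simp [χ]
      · rw [hj, Fin.insertNth_apply_same, Fin.insertNth_apply_same]
      · rw [Fin.insertNth_apply_above hj, Fin.insertNth_apply_above hj]
        have : ¬ (m + (j : ℕ) - 1 < m) := by
          have : (p : ℕ) < m + j := hj
          omega
        simp [χ, this]
    change symmetrize s (n + 1) (tensor (measurePreserving_split s h') _ _) =
      symmetrize s (n + 1) (tensorHead f (tensor (measurePreserving_split s h) _ _))
    conv_lhs => rw [← hχ₃, ← hχ₄]
    conv_rhs => rw [← hχ₁, ← hχ₂]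
    rw [tensor_split_prodVec, tensor_split_prodVec, ← permL_cycleRange_tensorHead_prodVec,
      symmetrize_permL]
  exact congrArg (fun T => T ξ) H

theorem symmetrize_amplUnsymm_permL (h : m ≤ n) (h' : m ≤ n + 1) (C : Symm s m →L[ℂ] Symm s m)
    {p : Fin (n + 1)} (hp : m ≤ (p : ℕ)) (f : OneParticle s) (ψ : Unsymm s n) :
    symmetrize s (n + 1) (amplUnsymm h' C (permL s (n + 1) p.cycleRange (tensorHead f ψ))) =
      symmetrize s (n + 1) (tensorHead f (amplUnsymm h C ψ)) := by
  have H : symmetrize s (n + 1) ∘L amplUnsymm h' C ∘L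
      (permL s (n + 1) p.cycleRange).toContinuousLinearMap ∘L tensorHead f =
      symmetrize s (n + 1) ∘L tensorHead f ∘L amplUnsymm h C := by
    refine ext_prodVec fun φ => ?_
    change symmetrize s (n + 1) (amplUnsymm h' C (permL s (n + 1) p.cycleRange
      (tensorHead f (prodVec φ)))) = symmetrize s (n + 1) (tensorHead f (amplUnsymm h C (prodVec φ)))
    rw [permL_cycleRange_tensorHead_prodVec, amplUnsymm_prodVec, amplUnsymm_prodVec,
      symmetrize_tensor_insertNth h h' hp]
    congr 7
    funext i
    rw [Fin.insertNth_apply_below (Fin.lt_def.2 (i.2.trans_le hp) : Fin.castLE h' i < p)]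
    simp only [eq_rec_constant]
    rfl
  exact congrArg (fun T => T ψ) H

theorem exists_shiftPerm {π : Equiv.Perm (Fin (n + 1))} (h : π 0 = 0) : ∃ e, π = shiftPerm e := by
  obtain ⟨⟨p, e⟩, rfl⟩ := Equiv.Perm.decomposeFin.symm.surjective π
  rw [Equiv.Perm.decomposeFin_symm_apply_zero] at h
  exact ⟨e, by rw [h]; rfl⟩

/-- The two permutations differ by one fixing 0, which acts trivially on f ⊗ Φ. -/
theorem permL_swap_eq_permL_cycleRange (p : Fin (n + 1)) (f : OneParticle s) (Φ : Symm s n) :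
    permL s (n + 1) (Equiv.swap 0 p) (tensorHead f (Φ : Unsymm s n)) =
      permL s (n + 1) p.cycleRange (tensorHead f (Φ : Unsymm s n)) := by
  obtain ⟨e, he⟩ := exists_shiftPerm (π := p.cycleRange * Equiv.swap 0 p) (by simp)
  have h1 : p.cycleRange = shiftPerm e * Equiv.swap 0 p := by
    rw [← he, mul_assoc, Equiv.swap_mul_self, mul_one]
  rw [h1, ← permL_permL, permL_shiftPerm_tensorHead, permL_symm]

theorem ampl_create (h' : m ≤ n + 1) (C : Symm s m →L[ℂ] Symm s m) (f : OneParticle s)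
    (Φ : Symm s n) : ampl h' C (create f n Φ) =
      (((Real.sqrt (n + 1) : ℝ) : ℂ) * ((n + 1 : ℕ) : ℂ)⁻¹) • ∑ p : Fin (n + 1),
        symmetrize s (n + 1) (amplUnsymm h' C (permL s (n + 1) p.cycleRange
          (tensorHead f (Φ : Unsymm s n)))) := by
  rw [ampl_apply, coe_create, Submodule.coe_smul, coe_symmetrize_tensorHead, smul_smul, map_smul,
    map_smul, map_sum, map_sum]
  simp only [permL_swap_eq_permL_cycleRange]

/-- The m slots on which C acts contribute 0 in the limit, and the n + 1 - m spectator slots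
contribute equal vectors. A difference is used because each of the two terms tends only weakly to 0.
-/
theorem tendsto_ampl_create_sub (h : m ≤ n) {C : Symm s m →L[ℂ] Symm s m}
    (hC : IsCompactOperator C) (f : Test s) (Φ : Symm s n) :
    Tendsto (fun x => ampl (h.trans n.le_succ) C (create (translate x f.toL2) n Φ) -
      (((n + 1 : ℕ) - (m : ℕ) : ℂ) / ((n + 1 : ℕ) : ℂ)) •
        create (translate x f.toL2) n (ampl h C Φ)) (cocompact (Space s)) (𝓝 0) := by
  have h' : m ≤ n + 1 := h.trans n.le_succ
  have h1 : ∀ p ∈ Finset.univ.filter (fun p : Fin (n + 1) => (p : ℕ) < m),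
      Tendsto (fun x => symmetrize s (n + 1) (amplUnsymm h' C (permL s (n + 1) p.cycleRange
        (tensorHead (translate x f.toL2) (Φ : Unsymm s n))))) (cocompact (Space s)) (𝓝 0) := by
    intro p hp
    have h2 := ((symmetrize s (n + 1)).continuous.tendsto 0).comp
      (tendsto_amplUnsymm_permL h' hC (Finset.mem_filter.1 hp).2 f (Φ : Unsymm s n))
    rwa [map_zero] at h2
  have h3 := (tendsto_finsetSum _ h1).const_smul
    (((Real.sqrt (n + 1) : ℝ) : ℂ) * ((n + 1 : ℕ) : ℂ)⁻¹)
  rw [Finset.sum_const_zero, smul_zero] at h3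
  refine h3.congr fun x => ?_
  rw [eq_sub_iff_add_eq, ampl_create,
    ← Finset.sum_filter_add_sum_filter_not Finset.univ (fun p : Fin (n + 1) => (p : ℕ) < m),
    smul_add]
  congr 1
  have h4 : ∀ p ∈ Finset.univ.filter (fun p : Fin (n + 1) => ¬ (p : ℕ) < m),
      symmetrize s (n + 1) (amplUnsymm h' C (permL s (n + 1) p.cycleRange
        (tensorHead (translate x f.toL2) (Φ : Unsymm s n)))) =
      symmetrize s (n + 1) (tensorHead (translate x f.toL2) (amplUnsymm h C (Φ : Unsymm s n))) :=
    fun p hp => symmetrize_amplUnsymm_permL h h' C (not_lt.1 (Finset.mem_filter.1 hp).2) _ _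
  have h5 : (Finset.univ.filter (fun p : Fin (n + 1) => ¬ (p : ℕ) < m)).card = n + 1 - m := by
    rw [Finset.filter_not, Finset.card_sdiff_of_subset (Finset.filter_subset _ _),
      Fin.card_filter_val_lt, Finset.card_univ, Fintype.card_fin, min_eq_right h']
  rw [Finset.sum_congr rfl h4, Finset.sum_const, h5, coe_create, ampl_apply,
    symmetrize_tensorHead_symmetrize, ← Nat.cast_smul_eq_nsmul ℂ, smul_smul, smul_smul,
    Nat.cast_sub h']
  congr 1
  ring

/-- With m = n + 1 there is no spectator slot, so the top term of the sum disappears. -/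
theorem tendsto_ampl_create_self {C : Symm s (n + 1) →L[ℂ] Symm s (n + 1)}
    (hC : IsCompactOperator C) (f : Test s) (Φ : Symm s n) :
    Tendsto (fun x => ampl le_rfl C (create (translate x f.toL2) n Φ)) (cocompact (Space s))
      (𝓝 0) := by
  have h1 : ∀ p ∈ (Finset.univ : Finset (Fin (n + 1))),
      Tendsto (fun x => symmetrize s (n + 1) (amplUnsymm le_rfl C (permL s (n + 1) p.cycleRange
        (tensorHead (translate x f.toL2) (Φ : Unsymm s n))))) (cocompact (Space s)) (𝓝 0) := by
    intro p _
    have h2 := ((symmetrize s (n + 1)).continuous.tendsto 0).comp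
      (tendsto_amplUnsymm_permL le_rfl hC p.2 f (Φ : Unsymm s n))
    rwa [map_zero] at h2
  have h3 := (tendsto_finsetSum _ h1).const_smul
    (((Real.sqrt (n + 1) : ℝ) : ℂ) * ((n + 1 : ℕ) : ℂ)⁻¹)
  rw [Finset.sum_const_zero, smul_zero] at h3
  exact h3.congr fun x => (ampl_create _ _ _ _).symm

theorem restrict_eq_of_restrict_succ (hs : 1 ≤ s) {A : Fock s →L[ℂ] Fock s}
    (hA : A ∈ gaugeInvariantAlgebra s) {k : ℕ} {C : (m : ℕ) → Symm s m →L[ℂ] Symm s m}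
    (hC : ∀ m, IsCompactOperator (C m))
    (h : restrict A (k + 1) = incl s (k + 1) ∘L
      ∑ m : Fin (k + 2), ampl (Nat.lt_succ_iff.1 m.2) (C m)) :
    restrict A k = incl s k ∘L
      ∑ m : Fin (k + 1), (((k + 1 : ℕ) - (m : ℕ) : ℂ) / ((k + 1 : ℕ) : ℂ)) •
        ampl (Nat.lt_succ_iff.1 m.2) (C m) := by
  have := neBot_cocompact_space hs
  obtain ⟨f, hf⟩ := exists_toL2_ne_zero s
  set B : Symm s k →L[ℂ] Symm s k :=
    ∑ m : Fin (k + 1), (((k + 1 : ℕ) - (m : ℕ) : ℂ) / ((k + 1 : ℕ) : ℂ)) •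
      ampl (Nat.lt_succ_iff.1 m.2) (C m) with hB
  ext1 Φ
  change A (incl s k Φ) = incl s k (B Φ)
  -- The error in replacing A a*(f(x))Φ by a*(f(x))BΦ; it tends to 0 in norm.
  let D : Space s → Symm s (k + 1) := fun x =>
    (∑ m : Fin (k + 1), (ampl ((Nat.lt_succ_iff.1 m.2).trans k.le_succ) (C m)
        (create (translate x f.toL2) k Φ) -
      (((k + 1 : ℕ) - (m : ℕ) : ℂ) / ((k + 1 : ℕ) : ℂ)) •
        create (translate x f.toL2) k (ampl (Nat.lt_succ_iff.1 m.2) (C m) Φ))) +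
    ampl le_rfl (C (k + 1)) (create (translate x f.toL2) k Φ)
  have hD : Tendsto D (cocompact (Space s)) (𝓝 0) := by
    have h1 := (tendsto_finsetSum (Finset.univ : Finset (Fin (k + 1)))
      fun m _ => tendsto_ampl_create_sub (Nat.lt_succ_iff.1 m.2) (hC m) f Φ).add
        (tendsto_ampl_create_self (hC (k + 1)) f Φ)
    rwa [Finset.sum_const_zero, add_zero] at h1
  have hAD : ∀ x, A (incl s (k + 1) (create (translate x f.toL2) k Φ)) =
      incl s (k + 1) (create (translate x f.toL2) k (B Φ)) + incl s (k + 1) (D x) := by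
    intro x
    refine (congrArg (fun T => T (create (translate x f.toL2) k Φ)) h).trans ?_
    rw [← map_add, ContinuousLinearMap.comp_apply]
    congr 1
    rw [Fin.sum_univ_castSucc, add_apply, sum_apply, hB, sum_apply, map_sum]
    simp only [D, smul_apply, map_smul, Finset.sum_sub_distrib]
    rw [← add_assoc, add_sub_cancel]
    rfl
  have key : ∀ Ψ : Symm s k, ⟪Ψ, component s k (A (incl s k Φ))⟫_ℂ = ⟪Ψ, B Φ⟫_ℂ := by
    intro Ψ
    have h1 := tendsto_inner_create hA.1 f f Ψ Φ
    -- The limit formula for the identity evaluates the leading term, giving ⟨f,f⟩⟨Ψ,BΦ⟩ to be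
    -- compared with ⟨f,f⟩⟨Ψ,AΦ⟩.
    have h2 := tendsto_inner_create (one_mem (resolventAlgebra s)) f f Ψ (B Φ)
    have h3 : Tendsto (fun x => ⟪incl s (k + 1) (create (translate x f.toL2) k Ψ),
        incl s (k + 1) (D x)⟫_ℂ) (cocompact (Space s)) (𝓝 0) := by
      have h4 := (tendsto_norm_create_translate f Ψ).mul hD.norm
      rw [norm_zero, mul_zero] at h4
      refine squeeze_zero_norm (fun x => ?_) h4
      rw [← norm_incl (D x)]
      exact norm_inner_le_norm _ _
    have h5 := h2.add h3
    simp only [one_apply_eq_self, add_zero, ← inner_add_right, ← hAD] at h5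
    have h6 := tendsto_nhds_unique h1 h5
    have h7 := mul_left_cancel₀ (inner_self_ne_zero.2 hf) h6
    rwa [inner_incl_left, inner_incl_left, component_incl_self] at h7
  exact (apply_incl_eq_incl_component hA.2 Φ).trans (congrArg _ (ext_inner_left ℂ key))

end Amplification

end BoseResolvent

end

theorem lemma3p4 (s : ℕ) (hs : 1 ≤ s) (A : Fock s →L[ℂ] Fock s)
    (hA : A ∈ gaugeInvariantAlgebra s) (k : ℕ) :
    -- the particle number is `n = k + 1`
    (∀ f g : Fin (k + 1) → Test s,
      Tendsto (fun x : Space s => ⟪farVec g x, A (farVec f x)⟫_ℂ) (cocompact (Space s))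
        (𝓝 (((k + 1 : ℕ) : ℂ)⁻¹ * ⟪nearVec g, A (nearVec f)⟫_ℂ *
          ⟪(g (Fin.last k)).toL2, (f (Fin.last k)).toL2⟫_ℂ))) ∧
    ‖restrict A k‖ ≤ ‖restrict A (k + 1)‖ ∧
    ∀ C : (m : ℕ) → Symm s m →L[ℂ] Symm s m, (∀ m, IsCompactOperator (C m)) →
      restrict A (k + 1) = incl s (k + 1) ∘L
        ∑ m : Fin (k + 2), ampl (Nat.lt_succ_iff.1 m.2) (C m) →
      restrict A k = incl s k ∘L
        ∑ m : Fin (k + 1), (((k + 1 : ℕ) - (m : ℕ) : ℂ) / ((k + 1 : ℕ) : ℂ)) •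
          ampl (Nat.lt_succ_iff.1 m.2) (C m) := by
  exact ⟨fun f g => tendsto_inner_farVec hA.1 f g, norm_restrict_le_succ hs hA k,
    fun _ hC h => restrict_eq_of_restrict_succ hs hA hC h⟩
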